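/- \textbf{Theorem 1.} An instance of \textsc{Star Partition} consists of a finite simple undirected graph $G=(V,E)$ and a number $s\in\mathbb N$; the question is whether $V$ can be partitioned into $\lceil |V|/(s+1)\rceil$ pairwise disjoint subsets $V_1,V_2,\ldots$ such that each induced subgraph $G[V_i]$ contains an $s$-star $K_{1,s}$ as a (not necessarily induced) subgraph. A graph is a unit interval graph if its vertices can be represented by real intervals of one common length such that two distinct vertices are adjacent if and only if their intervals intersect. \textsc{Star Partition} is solvable in $O(n+m)$ time on unit interval graphs, where $n=|V|$ and $m=|E|$. That is, there are a random access machine program and a constant $c$ such that for every unit interval graph $G$ on the vertex set $\{0,\ldots,n-1\}$, given by $n$ and by adjacency lists (in any order, without an interval representation), and for every $s\in\mathbb N$ (part of the input), the program halts after at most $c\,(n+m+1)$ steps with output $1$ if $(G,s)$ is a yes-instance and with output $0$ otherwise. The machine charges unit cost for reading or writing a randomly accessed memory cell, for adding or subtracting $1$, and for comparing two numbers. -/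

import Mathlib

namespace StarPartition

open Set

/-! ## Graphs -/

/-- `G` is a unit interval graph: its vertices can be represented by closed real intervals
`[left v, left v + len]` of one common length, so that two distinct vertices are adjacent if and
only if their intervals intersect. -/
def IsUnitIntervalGraph {V : Type*} (G : SimpleGraph V) : Prop :=
  ∃ (len : ℝ) (left : V → ℝ), 0 < len ∧ ∀ u v : V, u ≠ v →
    (G.Adj u v ↔
      (Icc (left u) (left u + len) ∩ Icc (left v) (left v + len)).Nonempty)

/-- The `s`-star `K_{1,s}`. -/
abbrev star (s : ℕ) : SimpleGraph (Fin 1 ⊕ Fin s) :=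
  completeBipartiteGraph (Fin 1) (Fin s)

/-- `V` can be partitioned into `⌈|V| / (s + 1)⌉` pairwise disjoint subsets, each of which induces
a subgraph containing an `s`-star as a (not necessarily induced) subgraph. -/
def HasStarPartition {V : Type*} [Fintype V] (G : SimpleGraph V) (s : ℕ) : Prop :=
  ∃ P : Fin (Fintype.card V ⌈/⌉ (s + 1)) → Set V,
    (∀ i j, i ≠ j → Disjoint (P i) (P j)) ∧
    (⋃ i, P i) = univ ∧
    ∀ i, (star s).IsContained (G.induce (P i))

/-! ## Random access machine

The memory consists of arrays of natural numbers, of which a program addresses a fixed finite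
number; each array has cells `0, 1, 2, …`, accessible at random. The only arithmetic is adding and
subtracting `1`, so that in `t` steps a value grows by at most `O(t)`: with inputs of polynomial
size, unit cost is charged only for operations on words of logarithmic length. -/

/-- `σ a i` is the content of cell `i` of array `a`. -/
abbrev Mem : Type := ℕ → ℕ → ℕ

/-- Write the value `x` into cell `i` of array `a`. -/
def Mem.write (σ : Mem) (a i x : ℕ) : Mem :=
  Function.update σ a (Function.update (σ a) i x)

/-- Expressions: constants, random access to a cell, `e + 1`, and `e - 1` (with `0 - 1 = 0`). -/
inductive Expr : Type
  | lit (k : ℕ)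
  | cell (a : ℕ) (i : Expr)
  | succ (e : Expr)
  | pred (e : Expr)

def Expr.eval (σ : Mem) : Expr → ℕ
  | lit k => k
  | cell a i => σ a (i.eval σ)
  | succ e => e.eval σ + 1
  | pred e => e.eval σ - 1

/-- Evaluating an expression costs one step for each of its operations. -/
def Expr.cost : Expr → ℕ
  | lit _ => 1
  | cell _ i => i.cost + 1
  | succ e => e.cost + 1
  | pred e => e.cost + 1

/-- Conditions: comparisons and their Boolean combinations. -/
inductive Cond : Type
  | lt (e f : Expr)
  | eq (e f : Expr)
  | not (b : Cond)
  | and (b d : Cond)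

def Cond.Holds (σ : Mem) : Cond → Prop
  | lt e f => e.eval σ < f.eval σ
  | eq e f => e.eval σ = f.eval σ
  | not b => ¬ b.Holds σ
  | and b d => b.Holds σ ∧ d.Holds σ

def Cond.cost : Cond → ℕ
  | lt e f => e.cost + f.cost + 1
  | eq e f => e.cost + f.cost + 1
  | not b => b.cost + 1
  | and b d => b.cost + d.cost + 1

/-- Programs. `store a i e` writes the value of `e` into the cell of array `a` whose index is the
value of `i`; `loop b p` repeats `p` as long as `b` holds. -/
inductive Program : Type
  | skip
  | store (a : ℕ) (i e : Expr)
  | seq (p q : Program)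
  | ite (b : Cond) (p q : Program)
  | loop (b : Cond) (p : Program)

/-- `Run p σ τ t`: started in memory `σ`, the (deterministic) program `p` halts after exactly `t`
steps in memory `τ`. -/
inductive Run : Program → Mem → Mem → ℕ → Prop
  | skip (σ : Mem) : Run .skip σ σ 1
  | store (σ : Mem) (a : ℕ) (i e : Expr) :
      Run (.store a i e) σ (σ.write a (i.eval σ) (e.eval σ)) (i.cost + e.cost + 1)
  | seq {p q : Program} {σ τ υ : Mem} {t u : ℕ} :
      Run p σ τ t → Run q τ υ u → Run (.seq p q) σ υ (t + u)
  | iteTrue {b : Cond} {p q : Program} {σ τ : Mem} {t : ℕ} :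
      b.Holds σ → Run p σ τ t → Run (.ite b p q) σ τ (b.cost + t)
  | iteFalse {b : Cond} {p q : Program} {σ τ : Mem} {t : ℕ} :
      ¬ b.Holds σ → Run q σ τ t → Run (.ite b p q) σ τ (b.cost + t)
  | loopDone {b : Cond} {p : Program} {σ : Mem} :
      ¬ b.Holds σ → Run (.loop b p) σ σ b.cost
  | loopStep {b : Cond} {p : Program} {σ τ υ : Mem} {t u : ℕ} :
      b.Holds σ → Run p σ τ t → Run (.loop b p) τ υ u → Run (.loop b p) σ υ (b.cost + t + u)

/-! ## Input -/

/-- `L` is an adjacency list representation of `G`: `L v` lists the neighbours of `v`, in any order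
and without repetitions. -/
def IsAdjacencyList {n : ℕ} (G : SimpleGraph (Fin n)) (L : Fin n → List (Fin n)) : Prop :=
  ∀ v, (L v).Nodup ∧ ∀ w, w ∈ L v ↔ G.Adj v w

/-- The initial memory for a graph on `n` vertices with adjacency lists `L` and the number `s`.
Array `0` holds `n` and array `1` holds `s`, both in cell `0`. Array `3` holds the concatenation
of the lists `L 0, …, L (n - 1)`, and array `2` holds in cell `v ≤ n` the position in array `3`
where the list `L v` begins (for `v = n`: the total length). All other cells are `0`. -/
def inputMem {n : ℕ} (L : Fin n → List (Fin n)) (s : ℕ) : Mem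
  | 0, i => if i = 0 then n else 0
  | 1, i => if i = 0 then s else 0
  | 2, i => if i ≤ n then ((List.ofFn L).take i).flatten.length else 0
  | 3, i => ((List.ofFn L).flatten.map Fin.val).getD i 0
  | _, _ => 0

end StarPartition

/-! A unit interval graph has an umbrella order: sorting by left endpoints makes every vertex
between the two ends of an edge adjacent to both, so closed neighbourhoods are intervals of the
order.

Given such an order, star partitions are rigid (`IsUmbrella.hasStarPartition_iff`): if one exists,
then the blocks of `s + 1` consecutive vertices already form one. A block contains a spanning star
as soon as one of its vertices reaches both its first vertex `f` and its last vertex `l`. If no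
vertex does, the stars whose centre lies before `l` and does not reach `l` cover everything up to
`f` and nothing from `l` on. Their total size is a multiple of `s + 1` strictly between two
consecutive multiples, which is absurd (`HasStarPartition.exists_block_center`).

It remains to find the blocks of some umbrella order in linear time. The order is built as a growing
prefix `D`, with the invariant that some umbrella order of the whole graph begins with `D`; that
order is never computed and may change beyond `D` at every step. The changes are reversals and
rearrangements of unions of components (`IsUmbrella.exists_move`) and exchanges of twins
(`IsUmbrella.swap`).

A component is entered at an end. A breadth-first search from any vertex keeps the visited set
convex, so its last nonempty batch of new vertices contains the first or the last vertex of the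
component, and a vertex of minimum degree in that batch is a twin of such an end
(`IsLastBatchMin.exists_twin`, `IsUmbrella.exists_start`). After the last placed vertex `u`, a
neighbour of `u` outside `D` that minimizes the number of neighbours outside `D` minus the number
inside is a twin of the true successor (`IsUmbrella.exists_next`). When `u` has no neighbour outside
`D`, the component is finished.

Each pass scans every adjacency list at most once. The time is bounded by a potential: a multiple of
`weight`, the total size of the closed neighbourhoods of the vertices still to be treated, which is
`2m + n` for all vertices. -/

namespace StarPartition

open Finset

/-! ## Umbrella orders -/

section Umbrella

variable {V : Type*} {n : ℕ} {G : SimpleGraph V} {x : V ≃ Fin n}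

/-- An enumeration of the vertices is an umbrella order if every vertex between the two ends of an
edge is adjacent to both of them. -/
def IsUmbrella (G : SimpleGraph V) (x : V ≃ Fin n) : Prop :=
  ∀ a b c, x a < x b → x b < x c → G.Adj a c → G.Adj a b ∧ G.Adj b c

/-- Any injection into a linear order induces an enumeration. -/
theorem exists_equiv_lt_iff [Fintype V] {α : Type*} [LinearOrder α] (hn : Fintype.card V = n)
    (f : V → α) (hf : Function.Injective f) :
    ∃ e : V ≃ Fin n, ∀ a b, e a < e b ↔ f a < f b := by
  let _ : LinearOrder V := LinearOrder.lift' f hf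
  let e : Fin n ≃o V := Fintype.orderIsoFinOfCardEq V hn
  refine ⟨e.symm.toEquiv, fun a b => ?_⟩
  exact e.symm.lt_iff_lt

/-- For `left u ≤ left v`, the two intervals meet exactly when `left v ≤ left u + len`. Sorting by
left endpoint therefore makes adjacency monotone in the distance. -/
theorem IsUnitIntervalGraph.exists_isUmbrella {G : SimpleGraph (Fin n)}
    (h : IsUnitIntervalGraph G) : ∃ x : Fin n ≃ Fin n, IsUmbrella G x := by
  obtain ⟨len, left, hlen, hadj⟩ := h
  have hadj' : ∀ u v, u ≠ v → left u ≤ left v → (G.Adj u v ↔ left v ≤ left u + len) := by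
    intro u v huv hle
    rw [hadj u v huv]
    constructor
    · rintro ⟨z, hz⟩
      simp only [Set.mem_inter_iff, Set.mem_Icc] at hz
      linarith
    · intro h
      exact ⟨left v, by simp only [Set.mem_inter_iff, Set.mem_Icc]; constructor <;> constructor <;>
        linarith⟩
  -- Equal intervals are possible; the vertex as second component breaks ties and makes the sort key
  -- injective.
  obtain ⟨e, he⟩ := exists_equiv_lt_iff (Fintype.card_fin n)
    (fun v : Fin n => toLex (left v, v)) (fun a b hab => congrArg (fun p => (ofLex p).2) hab)
  have hle : ∀ a b, e a < e b → a ≠ b ∧ left a ≤ left b := by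
    intro a b hab
    refine ⟨fun h => by simp [h] at hab, ?_⟩
    rw [he, Prod.Lex.toLex_lt_toLex] at hab
    rcases hab with h | h
    · exact h.le
    · exact h.1.le
  refine ⟨e, fun a b c hab hbc hac => ?_⟩
  obtain ⟨h1, h2⟩ := hle a b hab
  obtain ⟨h3, h4⟩ := hle b c hbc
  obtain ⟨h5, h6⟩ := hle a c (hab.trans hbc)
  rw [hadj' a c h5 h6] at hac
  rw [hadj' a b h1 h2, hadj' b c h3 h4]
  constructor <;> linarith

/-- In an umbrella order, closed neighbourhoods are convex. -/
theorem IsUmbrella.reach (hx : IsUmbrella G x) {a b c : V} (hab : x a ≤ x b) (hbc : x b ≤ x c)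
    (h : a = c ∨ G.Adj a c) : (a = b ∨ G.Adj a b) ∧ (b = c ∨ G.Adj b c) := by
  rcases hab.eq_or_lt with h1 | h1
  · obtain rfl := x.injective h1
    exact ⟨.inl rfl, h⟩
  rcases hbc.eq_or_lt with h2 | h2
  · obtain rfl := x.injective h2
    exact ⟨h, .inl rfl⟩
  rcases h with rfl | h
  · exact absurd (h1.trans h2) (lt_irrefl _)
  · exact ⟨.inr (hx a b c h1 h2 h).1, .inr (hx a b c h1 h2 h).2⟩

theorem IsUmbrella.rev (hx : IsUmbrella G x) : IsUmbrella G (x.trans Fin.revPerm) := by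
  intro a b c hab hbc hac
  simp only [Equiv.trans_apply, Fin.revPerm_apply, Fin.rev_lt_rev] at hab hbc
  have := hx c b a hbc hab hac.symm
  exact ⟨this.2.symm, this.1.symm⟩

/-- Exchanging two twins is an automorphism of the graph. This is the only freedom needed to turn a
greedy choice into the right one. -/
theorem IsUmbrella.swap [DecidableEq V] (hx : IsUmbrella G x) {z w : V}
    (h : ∀ y, y ≠ z → y ≠ w → (G.Adj y z ↔ G.Adj y w)) :
    IsUmbrella G ((Equiv.swap z w).trans x) := by
  have key : ∀ a b, G.Adj (Equiv.swap z w a) (Equiv.swap z w b) ↔ G.Adj a b := by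
    intro a b
    rcases eq_or_ne a z with rfl | haz
    · rcases eq_or_ne b a with rfl | hba
      · simp
      rcases eq_or_ne b w with rfl | hbw
      · simp [G.adj_comm]
      · rw [Equiv.swap_apply_left, Equiv.swap_apply_of_ne_of_ne hba hbw, G.adj_comm, ← h b hba hbw,
          G.adj_comm]
    rcases eq_or_ne a w with rfl | haw
    · rcases eq_or_ne b a with rfl | hba
      · simp
      rcases eq_or_ne b z with rfl | hbz
      · simp [G.adj_comm]
      · rw [Equiv.swap_apply_right, Equiv.swap_apply_of_ne_of_ne hbz hba, G.adj_comm, h b hbz hba,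
          G.adj_comm]
    rw [Equiv.swap_apply_of_ne_of_ne haz haw]
    rcases eq_or_ne b z with rfl | hbz
    · rw [Equiv.swap_apply_left, h a haz haw]
    rcases eq_or_ne b w with rfl | hbw
    · rw [Equiv.swap_apply_right, h a haz haw]
    rw [Equiv.swap_apply_of_ne_of_ne hbz hbw]
  intro a b c hab hbc hac
  have := hx _ _ _ hab hbc ((key a c).2 hac)
  rwa [key, key] at this

theorem rank_eq_card [Fintype V] (x : V ≃ Fin n) (v : V) : (x v : ℕ) = #{u | x u < x v} := by
  have : ({u | x u < x v} : Finset V) = (Finset.Iio (x v)).map x.symm.toEmbedding := by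
    ext u
    simp [Finset.mem_map_equiv]
  rw [this, card_map, Fin.card_Iio]

/-- A down-closed set consists of the first positions. -/
theorem mem_iff_lt_card [Fintype V] {D : Finset V} (h : ∀ u ∈ D, ∀ v, v ∉ D → x u < x v) (v : V) :
    v ∈ D ↔ (x v : ℕ) < #D := by
  rw [rank_eq_card x v]
  constructor
  · intro hv
    apply card_lt_card
    refine ⟨fun u hu => ?_, fun hss => ?_⟩
    · by_contra hu'
      simp only [mem_filter, mem_univ, true_and] at hu
      exact absurd (h v hv u hu') (not_lt.2 hu.le)
    · simpa using hss hv
  · intro hv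
    by_contra hv'
    refine absurd (card_le_card (fun u hu => ?_)) (not_le.2 hv)
    simpa using h u hu v hv'

/-- A set of vertices without edges to its complement. -/
def IsAdjClosed (G : SimpleGraph V) (D : Finset V) : Prop :=
  ∀ a ∈ D, ∀ b, G.Adj a b → b ∈ D

theorem IsAdjClosed.mem_of_reachable {D : Finset V} (hD : IsAdjClosed G D) {a b : V} (ha : a ∈ D)
    (h : G.Reachable a b) : b ∈ D := by
  obtain ⟨p⟩ := h
  induction p with
  | nil => exact ha
  | cons hadj _ ih => exact ih (hD _ ha _ hadj)

/-- An extreme vertex of a union of components can be moved to the first position after a union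
of components that comes first. -/
theorem IsUmbrella.exists_move [Fintype V] [DecidableEq V] (hx : IsUmbrella G x)
    {D F : Finset V} (hD : IsAdjClosed G D) (hDx : ∀ v, v ∈ D ↔ (x v : ℕ) < #D)
    (hF : IsAdjClosed G F) (hDF : Disjoint D F) {w : V} (hw : w ∈ F)
    (hmin : (∀ v ∈ F, x w ≤ x v) ∨ ∀ v ∈ F, x v ≤ x w) :
    ∃ y : V ≃ Fin n, IsUmbrella G y ∧ (∀ v ∈ D, y v = x v) ∧ (∀ v, v ∈ D ↔ (y v : ℕ) < #D) ∧
      (y w : ℕ) = #D := by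
  classical
  have hn : Fintype.card V = n := by simpa using Fintype.card_congr x
  -- If `w` is the last vertex of `F`, the reversed order is used on `F`.
  obtain ⟨x', hx', hmin'⟩ : ∃ x' : V ≃ Fin n, IsUmbrella G x' ∧ ∀ v ∈ F, x' w ≤ x' v := by
    rcases hmin with h | h
    · exact ⟨x, hx, h⟩
    · exact ⟨_, hx.rev, fun v hv => by simpa using h v hv⟩
  have hDF' : ∀ v ∈ D, v ∉ F := fun v hv hv' => (Finset.disjoint_left.1 hDF) hv hv'
  -- The new order lists `D`, then `F`, then the rest. No edge joins two of these classes, so the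
  -- umbrella property only has to be checked inside each class.
  let f : V → ℕ ×ₗ Fin n := fun v =>
    if v ∈ D then toLex (0, x v) else if v ∈ F then toLex (1, x' v) else toLex (2, x v)
  have hfD : ∀ v ∈ D, f v = toLex (0, x v) := fun v hv => by simp [f, hv]
  have hfF : ∀ v ∈ F, f v = toLex (1, x' v) := fun v hv => by
    have : v ∉ D := fun h => hDF' v h hv
    simp [f, hv, this]
  have hfR : ∀ v, v ∉ D → v ∉ F → f v = toLex (2, x v) := fun v h1 h2 => by simp [f, h1, h2]
  have hcls : ∀ v, v ∈ D ∨ v ∈ F ∨ (v ∉ D ∧ v ∉ F) := by intro v; tauto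
  have hf : Function.Injective f := by
    intro a b hab
    rcases hcls a with ha | ha | ha <;> rcases hcls b with hb | hb | hb <;>
      first
      | rw [hfD a ha] at hab
      | rw [hfF a ha] at hab
      | rw [hfR a ha.1 ha.2] at hab
    all_goals
      first
      | rw [hfD b hb] at hab
      | rw [hfF b hb] at hab
      | rw [hfR b hb.1 hb.2] at hab
    all_goals first | (simp at hab; done) | simpa using hab
  obtain ⟨y, hy⟩ := exists_equiv_lt_iff hn f hf
  have hlow : ∀ u ∈ D, ∀ v, v ∉ D → y u < y v := by
    intro u hu v hv
    rw [hy, hfD u hu]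
    rcases hcls v with h | h | h
    · exact absurd h hv
    · rw [hfF v h, Prod.Lex.toLex_lt_toLex]; simp
    · rw [hfR v h.1 h.2, Prod.Lex.toLex_lt_toLex]; simp
  have hyD : ∀ v ∈ D, ∀ u, y u < y v ↔ x u < x v := by
    intro v hv u
    by_cases hu : u ∈ D
    · rw [hy, hfD u hu, hfD v hv, Prod.Lex.toLex_lt_toLex]; simp
    · refine iff_of_false (hlow v hv u hu).not_gt ?_
      have h1 := (hDx v).1 hv
      have h2 := mt (hDx u).2 hu
      rw [Fin.lt_def]
      omega
  refine ⟨y, ?_, ?_, mem_iff_lt_card hlow, ?_⟩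
  · intro a b c hab hbc hac
    rw [hy] at hab hbc
    rcases hcls a with ha | ha | ha
    · have hc := hD a ha c hac
      have hb : b ∈ D := by
        by_contra hb
        have := hlow c hc b hb
        rw [hy] at this
        exact absurd hbc this.not_gt
      rw [hfD a ha, hfD b hb, Prod.Lex.toLex_lt_toLex] at hab
      rw [hfD b hb, hfD c hc, Prod.Lex.toLex_lt_toLex] at hbc
      exact hx a b c (by simpa using hab) (by simpa using hbc) hac
    · have hc := hF a ha c hac
      have hb : b ∈ F := by
        rcases hcls b with hb | hb | hb
        · rw [hfF a ha, hfD b hb, Prod.Lex.toLex_lt_toLex] at hab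
          simp at hab
        · exact hb
        · rw [hfF c hc, hfR b hb.1 hb.2, Prod.Lex.toLex_lt_toLex] at hbc
          simp at hbc
      rw [hfF a ha, hfF b hb, Prod.Lex.toLex_lt_toLex] at hab
      rw [hfF b hb, hfF c hc, Prod.Lex.toLex_lt_toLex] at hbc
      exact hx' a b c (by simpa using hab) (by simpa using hbc) hac
    · have hc : c ∉ D ∧ c ∉ F :=
        ⟨fun h => ha.1 (hD c h a hac.symm), fun h => ha.2 (hF c h a hac.symm)⟩
      have hb : b ∉ D ∧ b ∉ F := by
        rcases hcls b with hb | hb | hb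
        · rw [hfR a ha.1 ha.2, hfD b hb, Prod.Lex.toLex_lt_toLex] at hab
          simp at hab
        · rw [hfR a ha.1 ha.2, hfF b hb, Prod.Lex.toLex_lt_toLex] at hab
          simp at hab
        · exact hb
      rw [hfR a ha.1 ha.2, hfR b hb.1 hb.2, Prod.Lex.toLex_lt_toLex] at hab
      rw [hfR b hb.1 hb.2, hfR c hc.1 hc.2, Prod.Lex.toLex_lt_toLex] at hbc
      exact hx a b c (by simpa using hab) (by simpa using hbc) hac
  · intro v hv
    apply Fin.ext
    rw [rank_eq_card y v, rank_eq_card x v]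
    congr 1
    ext u
    simp [hyD v hv u]
  · rw [rank_eq_card y w]
    congr 1
    ext u
    simp only [mem_filter, mem_univ, true_and]
    refine ⟨fun h => ?_, fun h => hlow u h w (fun h' => hDF' w h' hw)⟩
    rcases hcls u with hu | hu | hu
    · exact hu
    · rw [hy, hfF u hu, hfF w hw, Prod.Lex.toLex_lt_toLex] at h
      exact absurd (hmin' u hu) (not_le.2 (by simpa using h))
    · rw [hy, hfR u hu.1 hu.2, hfF w hw, Prod.Lex.toLex_lt_toLex] at h
      simp at h

end Umbrella

end StarPartition

namespace StarPartition

open Finset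

/-! ### Greedy choices justified by twins -/

section Neighbours

variable {V : Type*} [Fintype V] {n : ℕ} {G : SimpleGraph V} {x : V ≃ Fin n}

/-- The neighbours of `v`. -/
noncomputable def nbr (G : SimpleGraph V) (v : V) : Finset V := by
  classical exact {w | G.Adj v w}

@[simp]
theorem mem_nbr {v w : V} : w ∈ nbr G v ↔ G.Adj v w := by
  simp [nbr]

theorem sum_card_nbr (G : SimpleGraph V) : ∑ v, #(nbr G v) = 2 * G.edgeSet.ncard := by
  classical
  have h := G.sum_degrees_eq_twice_card_edges
  rw [Set.ncard_eq_toFinset_card', ← SimpleGraph.edgeFinset, ← h]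
  refine sum_congr rfl fun v _ => ?_
  rw [← SimpleGraph.card_neighborFinset_eq_degree]
  congr 1
  ext w
  simp

/-- Two vertices with nested closed neighbourhoods and comparable degrees are twins. -/
theorem adj_iff_adj_of_card_le {l w : V} (hlw : G.Adj l w) (hsub : ∀ y, y ≠ w → G.Adj l y → G.Adj w y)
    (hcard : #(nbr G w) ≤ #(nbr G l)) (y : V) (hyl : y ≠ l) (hyw : y ≠ w) :
    G.Adj y l ↔ G.Adj y w := by
  classical
  -- The two sets are neighbourhoods with the edge `lw` removed on both sides; inclusion and the
  -- degree bound force equality.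
  have hss : (nbr G l).erase w ⊆ (nbr G w).erase l := by
    intro y hy
    simp only [mem_erase, mem_nbr] at hy ⊢
    exact ⟨fun h => G.loopless.irrefl l (h ▸ hy.2), hsub y hy.1 hy.2⟩
  have heq := eq_of_subset_of_card_le hss (by
    rw [card_erase_of_mem (by simpa using hlw.symm), card_erase_of_mem (by simpa using hlw)]
    omega)
  have := congrArg (y ∈ ·) heq
  simp only [mem_erase, mem_nbr, ne_eq, hyl, hyw, not_false_eq_true, true_and, eq_iff_iff] at this
  rw [G.adj_comm, this, G.adj_comm]

/-- `F` is convex with respect to the enumeration `x`. -/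
def IsConvex (x : V ≃ Fin n) (F : Finset V) : Prop :=
  ∀ a ∈ F, ∀ c ∈ F, ∀ b, x a < x b → x b < x c → b ∈ F

/-- Whatever lies between `u` and a neighbour of `u` is itself a neighbour of `u`. Hence a search
that absorbs whole neighbourhoods keeps its visited set convex. -/
theorem IsConvex.union_nbr [DecidableEq V] (hx : IsUmbrella G x) {F : Finset V}
    (hF : IsConvex x F) {u : V} (hu : u ∈ F) : IsConvex x (F ∪ nbr G u) := by
  have aux : ∀ a b, (a ∈ F ∨ G.Adj u a) → (x a < x b ∧ x b < x u ∨ x u < x b ∧ x b < x a) →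
      b ∈ F ∨ G.Adj u b := by
    rintro a b (ha | ha) (⟨h1, h2⟩ | ⟨h1, h2⟩)
    · exact .inl (hF a ha u hu b h1 h2)
    · exact .inl (hF u hu a ha b h1 h2)
    · exact .inr (hx a b u h1 h2 ha.symm).2.symm
    · exact .inr (hx u b a h1 h2 ha).1
  intro a ha c hc b hab hbc
  simp only [mem_union, mem_nbr] at ha hc ⊢
  rcases lt_trichotomy (x b) (x u) with h | h | h
  · exact aux a b ha (.inl ⟨hab, h⟩)
  · exact .inl (x.injective h ▸ hu)
  · exact aux c b hc (.inr ⟨h, hbc⟩)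

/-- `w` has minimum degree in the last set of vertices by which a search has reached `F`: these are
the vertices of `F` outside a convex set `F₀`, and they are adjacent to one vertex of `F₀`. -/
def IsLastBatchMin (G : SimpleGraph V) (x : V ≃ Fin n) (F : Finset V) (w : V) : Prop :=
  F = {w} ∨ ∃ (F₀ : Finset V) (u : V), u ∈ F₀ ∧ F₀ ⊆ F ∧ IsConvex x F₀ ∧ w ∈ F ∧ w ∉ F₀ ∧
    ∀ y ∈ F, y ∉ F₀ → G.Adj u y ∧ #(nbr G w) ≤ #(nbr G y)

theorem IsLastBatchMin.mem {F : Finset V} {w : V} (h : IsLastBatchMin G x F w) : w ∈ F := by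
  rcases h with rfl | ⟨_, _, _, _, _, h, _⟩
  · simp
  · exact h

/-- The vertex found last by a search is a twin of the first or the last vertex of its component. -/
theorem IsLastBatchMin.exists_twin (hx : IsUmbrella G x) {F : Finset V} {w : V}
    (hF : IsAdjClosed G F) (h : IsLastBatchMin G x F w) :
    ∃ l ∈ F, (∀ y, y ≠ l → y ≠ w → (G.Adj y l ↔ G.Adj y w)) ∧
      ((∀ v ∈ F, x l ≤ x v) ∨ ∀ v ∈ F, x v ≤ x l) := by
  rcases h with rfl | ⟨F₀, u, hu, hF₀, hconv, hwF, hw, hmin⟩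
  · exact ⟨w, by simp, fun _ _ _ => Iff.rfl, .inl (by simp)⟩
  -- By symmetry under reversal, `w` may be assumed to come before `u`; the end in question is then
  -- the first vertex `l` of `F`.
  have main : ∀ z : V ≃ Fin n, IsUmbrella G z → IsConvex z F₀ → z w < z u →
      ∃ l ∈ F, (∀ y, y ≠ l → y ≠ w → (G.Adj y l ↔ G.Adj y w)) ∧ ∀ v ∈ F, z l ≤ z v := by
    intro z hz hconv hwu
    obtain ⟨l, hl, hlmin⟩ := exists_min_image F z ⟨w, hwF⟩
    refine ⟨l, hl, ?_, hlmin⟩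
    rcases eq_or_ne l w with rfl | hlw
    · exact fun _ _ _ => Iff.rfl
    have hlw' : z l < z w := lt_of_le_of_ne (hlmin w hwF) (fun h => hlw (z.injective h))
    -- Convexity of `F₀` would put `w`, which lies between `l` and `u`, into `F₀`. So `l` belongs to
    -- the last batch and its degree is at least that of `w`.
    have hl₀ : l ∉ F₀ := fun h => hw (hconv l h u hu w hlw' hwu)
    obtain ⟨hul, hcard⟩ := hmin l hl hl₀
    have hadj := (hz l w u hlw' hwu hul.symm).1
    refine adj_iff_adj_of_card_le hadj (fun y hyw hly => ?_) hcard
    have hyF := hF l hl y hly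
    have hly' : z l < z y :=
      lt_of_le_of_ne (hlmin y hyF) (fun h => G.loopless.irrefl l (by rwa [← z.injective h] at hly))
    rcases lt_or_gt_of_ne (fun h => hyw (z.injective h) : z y ≠ z w) with h | h
    -- All neighbours of `l` lie after `l`, so each is adjacent to `w`, whether it lies before or
    -- after `w`.
    · exact (hz l y w hly' h hadj).2.symm
    · exact (hz l w y hlw' h hly).2
  have hne : x w ≠ x u := fun h => hw (x.injective h ▸ hu)
  rcases lt_or_gt_of_ne hne with h | h
  · obtain ⟨l, hl, h1, h2⟩ := main x hx hconv h
    exact ⟨l, hl, h1, .inl h2⟩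
  · obtain ⟨l, hl, h1, h2⟩ := main _ hx.rev
      (fun a ha c hc b hab hbc => hconv c hc a ha b (by simpa using hbc) (by simpa using hab))
      (by simpa using h)
    exact ⟨l, hl, h1, .inr (by simpa using h2)⟩

/-- The vertex found last by the search through a component can be made the next one. -/
theorem IsUmbrella.exists_start [DecidableEq V] (hx : IsUmbrella G x) {D F : Finset V}
    (hD : IsAdjClosed G D) (hDx : ∀ v, v ∈ D ↔ (x v : ℕ) < #D) (hF : IsAdjClosed G F)
    (hDF : Disjoint D F) {w : V} (h : IsLastBatchMin G x F w) :
    ∃ y : V ≃ Fin n, IsUmbrella G y ∧ (∀ v ∈ D, y v = x v) ∧ (∀ v, v ∈ D ↔ (y v : ℕ) < #D) ∧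
      (y w : ℕ) = #D := by
  obtain ⟨l, hl, htwin, hext⟩ := h.exists_twin hx hF
  have hw := h.mem
  have hDF' : ∀ v ∈ F, v ∉ D := fun v hv hv' => (Finset.disjoint_left.1 hDF) hv' hv
  have hsw : ∀ v ∈ D, Equiv.swap l w v = v := fun v hv =>
    Equiv.swap_apply_of_ne_of_ne (fun h => hDF' l hl (h ▸ hv)) (fun h => hDF' w hw (h ▸ hv))
  have hswF : ∀ v ∈ F, Equiv.swap l w v ∈ F := by
    intro v hv
    rw [Equiv.swap_apply_def]
    split_ifs <;> assumption
  have hDx' : ∀ v, v ∈ D ↔ (((Equiv.swap l w).trans x) v : ℕ) < #D := by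
    intro v
    rw [Equiv.trans_apply, ← hDx]
    constructor
    · intro hv
      rwa [hsw v hv]
    · intro hv
      have := hsw _ hv
      rw [Equiv.swap_apply_self] at this
      rwa [this]
  obtain ⟨y, hy, hyD, hyD', hyw⟩ := (hx.swap htwin).exists_move hD hDx' hF hDF hw (by
    simp only [Equiv.trans_apply, Equiv.swap_apply_right]
    rcases hext with h | h
    · exact .inl fun v hv => h _ (hswF v hv)
    · exact .inr fun v hv => h _ (hswF v hv))
  refine ⟨y, hy, fun v hv => ?_, hyD', hyw⟩
  rw [hyD v hv, Equiv.trans_apply, hsw v hv]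

/-- A neighbour of the current last vertex that minimizes the number of new minus the number of old
neighbours can be made the next vertex. -/
theorem IsUmbrella.exists_next [DecidableEq V] (hx : IsUmbrella G x) {D : Finset V}
    (hDx : ∀ v, v ∈ D ↔ (x v : ℕ) < #D) {u w : V} (hu : (x u : ℕ) + 1 = #D)
    (huw : G.Adj u w) (hw : w ∉ D)
    (hmin : ∀ y, G.Adj u y → y ∉ D →
      #(nbr G w \ D) + #(nbr G y ∩ D) ≤ #(nbr G y \ D) + #(nbr G w ∩ D)) :
    ∃ y : V ≃ Fin n, IsUmbrella G y ∧ (∀ v ∈ D, y v = x v) ∧ (∀ v, v ∈ D ↔ (y v : ℕ) < #D) ∧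
      (y w : ℕ) = #D := by
  have hw' : #D ≤ x w := not_lt.1 (mt (hDx w).2 hw)
  -- `z` is the present successor of `u`; the aim is to show that `z` and `w` are twins.
  let z : V := x.symm ⟨#D, hw'.trans_lt (x w).2⟩
  have hz : (x z : ℕ) = #D := by simp [z]
  have hzD : z ∉ D := fun h => by have := (hDx z).1 h; omega
  have huz : x u < x z := by rw [Fin.lt_def]; omega
  rcases eq_or_ne w z with hwz | hwz
  · exact ⟨x, hx, fun _ _ => rfl, hDx, hwz ▸ hz⟩
  have hzw : x z < x w := by
    rw [Fin.lt_def]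
    have : (x z : ℕ) ≠ x w := fun h => hwz (x.injective (Fin.ext h)).symm
    omega
  obtain ⟨hAuz, hAzw⟩ := hx u z w huz hzw huw
  have hlow : ∀ y, G.Adj w y → y ∈ D → G.Adj z y := by
    intro y hwy hy
    have : x y < x z := by
      rw [Fin.lt_def, hz]
      exact (hDx y).1 hy
    exact (hx y z w this hzw hwy.symm).1.symm
  have hhigh : ∀ y, G.Adj z y → y ∉ D → y ≠ w → G.Adj w y := by
    intro y hzy hy hyw
    have hzy' : x z < x y := by
      have h1 := mt (hDx y).2 hy
      have h2 : (x z : ℕ) ≠ x y := fun h =>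
        G.loopless.irrefl z (by rwa [← x.injective (Fin.ext h)] at hzy)
      rw [Fin.lt_def]
      omega
    rcases lt_or_gt_of_ne (fun h => hyw (x.injective h) : x y ≠ x w) with h | h
    · exact (hx z y w hzy' h hAzw).2.symm
    · exact (hx z w y hzw h hzy).2
  -- `z` lies between `D` and `w`: it sees at least as much of `D` as `w` does, and, apart from `z`
  -- and `w`, at most as much of the complement. So the quantity minimized by `w` is no larger at
  -- `z`, and minimality turns both inclusions into equalities.
  have hsub1 : nbr G w ∩ D ⊆ nbr G z ∩ D := by
    intro y
    simp only [mem_inter, mem_nbr]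
    exact fun h => ⟨hlow y h.1 h.2, h.2⟩
  have hsub2 : (nbr G z \ D).erase w ⊆ (nbr G w \ D).erase z := by
    intro y
    simp only [mem_erase, mem_sdiff, mem_nbr]
    exact fun h => ⟨fun h' => G.loopless.irrefl z (h' ▸ h.2.1), hhigh y h.2.1 h.2.2 h.1, h.2.2⟩
  have hwm : w ∈ nbr G z \ D := by simp [hAzw, hw]
  have hzm : z ∈ nbr G w \ D := by simp [hAzw.symm, hzD]
  have hc1 := card_le_card hsub1
  have hc2 := card_le_card hsub2
  rw [card_erase_of_mem hwm, card_erase_of_mem hzm] at hc2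
  have hp1 := card_pos.2 ⟨w, hwm⟩
  have hp2 := card_pos.2 ⟨z, hzm⟩
  have hle := hmin z hAuz hzD
  have heq1 := eq_of_subset_of_card_le hsub1 (by omega)
  have heq2 := eq_of_subset_of_card_le hsub2 (by
    rw [card_erase_of_mem hwm, card_erase_of_mem hzm]; omega)
  have htwin : ∀ y, y ≠ z → y ≠ w → (G.Adj y z ↔ G.Adj y w) := by
    intro y hyz hyw
    by_cases hy : y ∈ D
    · have := congrArg (y ∈ ·) heq1
      simp only [mem_inter, mem_nbr, hy, and_true, eq_iff_iff] at this
      rw [G.adj_comm, ← this, G.adj_comm]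
    · have := congrArg (y ∈ ·) heq2
      simp only [mem_erase, mem_sdiff, mem_nbr, hy, hyz, hyw, ne_eq, not_false_eq_true, true_and,
        and_true, eq_iff_iff] at this
      rw [G.adj_comm, this, G.adj_comm]
  have hsw : ∀ v ∈ D, Equiv.swap z w v = v := fun v hv =>
    Equiv.swap_apply_of_ne_of_ne (fun h => hzD (h ▸ hv)) (fun h => hw (h ▸ hv))
  refine ⟨_, hx.swap htwin, fun v hv => ?_, fun v => ?_, ?_⟩
  · rw [Equiv.trans_apply, hsw v hv]
  · rw [Equiv.trans_apply, ← hDx]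
    constructor
    · intro hv
      rwa [hsw v hv]
    · intro hv
      have := hsw _ hv
      rw [Equiv.swap_apply_self] at this
      rwa [this]
  · simp [hz]

end Neighbours

end StarPartition

namespace StarPartition

open Finset

/-! ### Star partitions and consecutive blocks -/

section Stars

variable {V : Type*} [Fintype V] {n s : ℕ} {G : SimpleGraph V} {x : V ≃ Fin n}

/-- A partition into stars, by its parts and their centres. -/
theorem HasStarPartition.exists_centers (h : HasStarPartition G s) :
    (s + 1) ∣ Fintype.card V ∧ ∃ (k : ℕ) (p : V → Fin k) (c : Fin k → V),
      (∀ i, p (c i) = i) ∧ (∀ i, #{v | p v = i} = s + 1) ∧ ∀ v, c (p v) = v ∨ G.Adj (c (p v)) v := by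
  classical
  unfold HasStarPartition at h
  generalize hk : Fintype.card V ⌈/⌉ (s + 1) = k at h
  obtain ⟨P, hdis, hcov, hstar⟩ := h
  have hkle : Fintype.card V ≤ (s + 1) * k := by
    simpa [smul_eq_mul] using (ceilDiv_le_iff_le_smul (b := Fintype.card V) (c := k)
      (Nat.succ_pos s)).1 hk.le
  have hex : ∀ v, ∃ i, v ∈ P i := fun v => by
    have : v ∈ ⋃ i, P i := hcov ▸ Set.mem_univ v
    simpa using this
  choose p hp using hex
  have hpi : ∀ v i, v ∈ P i ↔ p v = i := by
    intro v i
    constructor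
    · intro hv
      by_contra hne
      exact Set.disjoint_left.1 (hdis _ _ hne) (hp v) hv
    · rintro rfl
      exact hp v
  have hf : ∀ i, ∃ f : Fin 1 ⊕ Fin s → V, Function.Injective f ∧ (∀ a, p (f a) = i) ∧
      ∀ j, G.Adj (f (.inl 0)) (f (.inr j)) := by
    intro i
    obtain ⟨f⟩ := hstar i
    refine ⟨fun a => (f a).1, fun a b hab => f.injective (Subtype.ext hab),
      fun a => (hpi _ _).1 (f a).2, fun j => ?_⟩
    have := f.toHom.map_adj (v := .inl 0) (w := .inr j) (by simp [star])
    simpa using this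
  choose f hfinj hfp hfadj using hf
  have himg : ∀ i, (univ : Finset (Fin 1 ⊕ Fin s)).image (f i) ⊆ ({v | p v = i} : Finset V) := by
    intro i v hv
    obtain ⟨a, _, rfl⟩ := mem_image.1 hv
    simpa using hfp i a
  have himgc : ∀ i, #((univ : Finset (Fin 1 ⊕ Fin s)).image (f i)) = s + 1 := by
    intro i
    rw [card_image_of_injective _ (hfinj i)]
    simp [add_comm]
  have hge : ∀ i ∈ (univ : Finset (Fin k)), s + 1 ≤ #({v | p v = i} : Finset V) := fun i _ =>
    himgc i ▸ card_le_card (himg i)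
  have hsum : Fintype.card V = ∑ i, #({v | p v = i} : Finset V) := by
    rw [← card_univ]
    exact card_eq_sum_card_fiberwise (fun _ _ => by simp)
  -- There are `⌈|V|/(s+1)⌉` parts with at least `s + 1` vertices each. Comparing totals leaves no
  -- slack: every part has exactly `s + 1` vertices and its star spans it.
  have hsum' : ∑ _i : Fin k, (s + 1) = ∑ i, #({v | p v = i} : Finset V) := by
    refine le_antisymm (sum_le_sum hge) ?_
    rw [← hsum]
    simpa [mul_comm] using hkle
  have hall : ∀ i, #({v | p v = i} : Finset V) = s + 1 := fun i =>
    ((sum_eq_sum_iff_of_le hge).1 hsum' i (mem_univ i)).symm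
  refine ⟨?_, k, p, fun i => f i (.inl 0), fun i => hfp i _, hall, fun v => ?_⟩
  · rw [hsum, ← hsum']
    simp
  · have hv : v ∈ (univ : Finset (Fin 1 ⊕ Fin s)).image (f (p v)) := by
      rw [eq_of_subset_of_card_le (himg (p v)) (by rw [hall, himgc])]
      simp
    obtain ⟨a, _, ha⟩ := mem_image.1 hv
    rcases a with a | j
    · left
      rwa [Subsingleton.elim a 0] at ha
    · right
      have h1 := hfadj (p v) j
      rw [ha] at h1
      exact h1

theorem div_succ_eq_iff {m s b : ℕ} :
    m / (s + 1) = b ↔ b * (s + 1) ≤ m ∧ m ≤ b * (s + 1) + s := by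
  rw [Nat.div_eq_iff (by omega : 0 < s + 1)]
  exact Iff.rfl

theorem card_block (x : V ≃ Fin n) {b : ℕ} (hb : (b + 1) * (s + 1) ≤ n) :
    #({v | (x v : ℕ) / (s + 1) = b} : Finset V) = s + 1 := by
  have : (({v | (x v : ℕ) / (s + 1) = b} : Finset V).map x.toEmbedding).map Fin.valEmbedding =
      Finset.Ico (b * (s + 1)) ((b + 1) * (s + 1)) := by
    ext i
    simp only [mem_map, mem_filter, mem_univ, true_and, Equiv.coe_toEmbedding,
      Fin.valEmbedding_apply, mem_Ico, exists_exists_and_eq_and]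
    constructor
    · rintro ⟨v, hv, rfl⟩
      rw [div_succ_eq_iff] at hv
      refine ⟨hv.1, ?_⟩
      rw [add_mul]
      omega
    · rintro ⟨h1, h2⟩
      refine ⟨x.symm ⟨i, by omega⟩, ?_, by simp⟩
      rw [div_succ_eq_iff]
      rw [add_mul] at h2
      simp only [Equiv.apply_symm_apply]
      omega
  rw [← card_map, ← card_map Fin.valEmbedding, this, Nat.card_Ico, add_mul]
  omega

/-- In a graph with a partition into stars, every block of an umbrella order contains a star. -/
theorem HasStarPartition.exists_block_center (h : HasStarPartition G s) (hx : IsUmbrella G x)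
    {b : ℕ} (hb : (b + 1) * (s + 1) ≤ n) :
    ∃ v, (x v : ℕ) / (s + 1) = b ∧ ∀ w, (x w : ℕ) / (s + 1) = b → v = w ∨ G.Adj v w := by
  classical
  obtain ⟨-, k, p, c, hpc, hfib, hreach⟩ := h.exists_centers
  have hbs : (b + 1) * (s + 1) = b * (s + 1) + (s + 1) := by ring
  have hdiv : ∀ v, (x v : ℕ) / (s + 1) = b ↔ b * (s + 1) ≤ x v ∧ (x v : ℕ) ≤ b * (s + 1) + s :=
    fun v => div_succ_eq_iff
  let f : V := x.symm ⟨b * (s + 1), by omega⟩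
  let l : V := x.symm ⟨b * (s + 1) + s, by omega⟩
  have hf : (x f : ℕ) = b * (s + 1) := by simp [f]
  have hl : (x l : ℕ) = b * (s + 1) + s := by simp [l]
  -- By convexity of closed neighbourhoods, a vertex of the block that reaches both ends reaches the
  -- whole block.
  suffices H : ∃ v, x f ≤ x v ∧ x v ≤ x l ∧ (f = v ∨ G.Adj f v) ∧ (v = l ∨ G.Adj v l) by
    obtain ⟨v, h1, h2, h3, h4⟩ := H
    rw [Fin.le_def] at h1 h2
    refine ⟨v, (hdiv v).2 ⟨hf ▸ h1, hl ▸ h2⟩, fun w hw => ?_⟩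
    obtain ⟨h5, h6⟩ := (hdiv w).1 hw
    rcases le_total (x w) (x v) with h | h
    · have := (hx.reach (a := f) (b := w) (c := v) (by rw [Fin.le_def]; omega) h h3).2
      rwa [eq_comm, G.adj_comm]
    · exact (hx.reach (a := v) (b := w) (c := l) h (by rw [Fin.le_def]; omega) h4).1
  by_contra! H
  have hfl : ¬ (f = l ∨ G.Adj f l) := fun h' =>
    absurd h' (by
      have := H f le_rfl (by rw [Fin.le_def]; omega) (.inl rfl)
      tauto)
  -- The parts whose centre lies before `l` and does not reach `l`.
  let A : Finset (Fin k) := {i | x (c i) < x l ∧ ¬ (c i = l ∨ G.Adj (c i) l)}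
  -- A centre `d` of some `v ≤ f` cannot lie beyond `l`, since then `v` and hence `f` would reach
  -- `l`. Nor can it reach `l`: from inside the block it would also reach `f`, and from before `f`
  -- it would make `f` reach `l`.
  have hlow : ({v | x v ≤ x f} : Finset V) ⊆ ({v | p v ∈ A} : Finset V) := by
    intro v hv
    simp only [mem_filter, mem_univ, true_and, A] at hv ⊢
    set d := c (p v)
    have hr : d = v ∨ G.Adj d v := hreach v
    have hle : x d ≤ x l := by
      by_contra! hgt
      have h1 := (hx.reach (a := v) (b := l) (c := d) (hv.trans (by rw [Fin.le_def]; omega)) hgt.le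
        (by rwa [eq_comm, G.adj_comm])).1
      exact hfl (hx.reach hv (by rw [Fin.le_def]; omega) h1).2
    have hnr : ¬ (d = l ∨ G.Adj d l) := by
      intro hdl
      rcases le_total (x f) (x d) with h1 | h1
      · have h2 := (hx.reach hv h1 (by rwa [eq_comm, G.adj_comm])).2
        have := H d h1 hle h2
        tauto
      · exact hfl (hx.reach h1 (by rw [Fin.le_def]; omega) hdl).2
    exact ⟨lt_of_le_of_ne hle (fun h' => hnr (.inl (x.injective h'))), hnr⟩
  have hup : ({v | p v ∈ A} : Finset V) ⊆ ({v | x v < x l} : Finset V) := by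
    intro v hv
    simp only [mem_filter, mem_univ, true_and, A] at hv ⊢
    by_contra! hge
    exact hv.2 (hx.reach hv.1.le hge (hreach v)).1
  have hA : #({v | p v ∈ A} : Finset V) = #A * (s + 1) := by
    rw [card_eq_sum_card_fiberwise (t := A) (f := p) (fun v hv => by simpa using hv),
      sum_const_nat (m := s + 1)]
    intro i hi
    rw [← hfib i]
    congr 1
    ext v
    simp only [mem_filter, mem_univ, true_and, and_iff_right_iff_imp]
    rintro rfl
    exact hi
  have h1 := card_le_card hlow
  have h2 := card_le_card hup
  have h3 : #({v | x v ≤ x f} : Finset V) = b * (s + 1) + 1 := by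
    have : ({v | x v ≤ x f} : Finset V) = insert f ({v | x v < x f} : Finset V) := by
      ext v
      simp only [mem_filter, mem_univ, true_and, mem_insert, le_iff_eq_or_lt, x.injective.eq_iff]
    rw [this, card_insert_of_notMem (by simp), ← rank_eq_card, hf]
  rw [← rank_eq_card, hl, hA] at h2
  rw [h3, hA] at h1
  -- The counts read `b(s+1) + 1 ≤ #A(s+1) ≤ b(s+1) + s`, which no integer `#A` satisfies.
  have h4 : b < #A := by
    by_contra! h'
    have := Nat.mul_le_mul_right (s + 1) h'
    omega
  have := Nat.mul_le_mul_right (s + 1) (Nat.succ_le_of_lt h4)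
  rw [Nat.succ_eq_add_one] at this
  omega

/-- A graph has a partition into stars if and only if the blocks of an umbrella order form one. -/
theorem IsUmbrella.hasStarPartition_iff (hx : IsUmbrella G x) :
    HasStarPartition G s ↔ n % (s + 1) = 0 ∧
      ∀ b < n / (s + 1), ∃ v, (x v : ℕ) / (s + 1) = b ∧
        #({w ∈ nbr G v | (x w : ℕ) / (s + 1) = (x v : ℕ) / (s + 1)}) = s := by
  classical
  have hn : Fintype.card V = n := by simpa using Fintype.card_congr x
  have hle : ∀ b, b < n / (s + 1) → (b + 1) * (s + 1) ≤ n := fun b hb =>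
    (Nat.mul_le_mul_right _ hb).trans (Nat.div_mul_le_self n (s + 1))
  constructor
  · intro h
    refine ⟨Nat.mod_eq_zero_of_dvd (hn ▸ h.exists_centers.1), fun b hb => ?_⟩
    obtain ⟨v, hv, hall⟩ := h.exists_block_center hx (hle b hb)
    refine ⟨v, hv, ?_⟩
    have heq : ({w ∈ nbr G v | (x w : ℕ) / (s + 1) = (x v : ℕ) / (s + 1)}) =
        ({w | (x w : ℕ) / (s + 1) = b} : Finset V).erase v := by
      ext w
      simp only [mem_filter, mem_nbr, mem_erase, mem_univ, true_and, hv]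
      constructor
      · exact fun h => ⟨h.1.ne', h.2⟩
      · exact fun h => ⟨(hall w h.2).resolve_left (fun h' => h.1 h'.symm), h.2⟩
    rw [heq, card_erase_of_mem (by simpa using hv), card_block x (hle b hb)]
    rfl
  · rintro ⟨hmod, hblk⟩
    have hk : Fintype.card V ⌈/⌉ (s + 1) = n / (s + 1) := by
      rw [hn, Nat.ceilDiv_eq_add_pred_div]
      obtain ⟨q, hq⟩ := Nat.dvd_of_mod_eq_zero hmod
      rw [hq, Nat.mul_div_cancel_left _ (Nat.succ_pos s), add_tsub_assoc_of_le (by omega),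
        Nat.mul_add_div (Nat.succ_pos s)]
      simp
    refine ⟨fun i => {v | (x v : ℕ) / (s + 1) = i}, ?_, ?_, ?_⟩
    · intro i j hij
      rw [Set.disjoint_left]
      intro v hv hv'
      exact hij (Fin.ext (hv.symm.trans hv'))
    · ext v
      simp only [Set.mem_iUnion, Set.mem_ofPred_eq, Set.mem_univ, iff_true]
      refine ⟨⟨(x v : ℕ) / (s + 1), ?_⟩, rfl⟩
      rw [hk, Nat.div_lt_iff_lt_mul (Nat.succ_pos s),
        Nat.div_mul_cancel (Nat.dvd_of_mod_eq_zero hmod)]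
      exact (x v).2
    · intro i
      obtain ⟨v, hv, hcard⟩ := hblk i (hk ▸ i.2)
      let e := (equivFinOfCardEq hcard).symm
      have hmem : ∀ j, G.Adj v (e j) ∧ (x (e j : V) : ℕ) / (s + 1) = i := by
        intro j
        have := (e j).2
        rw [mem_filter, mem_nbr] at this
        exact ⟨this.1, this.2.trans hv⟩
      let F : Fin 1 ⊕ Fin s → {v | (x v : ℕ) / (s + 1) = i} :=
        Sum.elim (fun _ => ⟨v, hv⟩) (fun j => ⟨e j, (hmem j).2⟩)
      refine ⟨⟨⟨F, ?_⟩, ?_⟩⟩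
      · rintro (a | a) (b | b) hab
        · simp [star] at hab
        · simpa [F] using (hmem b).1
        · simpa [F] using (hmem a).1.symm
        · simp [star] at hab
      · rintro (a | a) (b | b) hab
        · rw [Subsingleton.elim a b]
        · exact absurd (congrArg Subtype.val hab) (hmem b).1.ne
        · exact absurd (congrArg Subtype.val hab) (hmem a).1.ne'
        · have := congrArg Subtype.val hab
          simpa [F] using this

end Stars

end StarPartition

namespace StarPartition

open Finset

/-! ## Reasoning about programs -/

section Machine

@[simp]
theorem Mem.write_apply (σ : Mem) (a i x b : ℕ) :
    σ.write a i x b = if b = a then Function.update (σ a) i x else σ b := by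
  simp [Mem.write, Function.update_apply]

/-- The program `p` contains a statement that writes to array `a`. -/
@[simp]
def Program.Writes : Program → ℕ → Prop
  | .skip, _ => False
  | .store a _ _, b => b = a
  | .seq p q, b => p.Writes b ∨ q.Writes b
  | .ite _ p q, b => p.Writes b ∨ q.Writes b
  | .loop _ p, b => p.Writes b

/-- `τ` agrees with `σ` on the arrays to which `p` does not write. -/
def Framed (p : Program) (σ τ : Mem) : Prop :=
  ∀ a, ¬ p.Writes a → τ a = σ a

theorem Framed.refl (p : Program) (σ : Mem) : Framed p σ σ := fun _ _ => rfl

theorem Framed.trans {p : Program} {σ τ υ : Mem} (h : Framed p σ τ) (h' : Framed p τ υ) :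
    Framed p σ υ := fun a ha => (h' a ha).trans (h a ha)

theorem Framed.mono {p q : Program} {σ τ : Mem} (h : Framed p σ τ)
    (hpq : ∀ a, p.Writes a → q.Writes a) : Framed q σ τ := fun a ha => h a (mt (hpq a) ha)

theorem Run.framed {p : Program} {σ τ : Mem} {t : ℕ} (h : Run p σ τ t) : Framed p σ τ := by
  induction h with
  | skip => exact fun _ _ => rfl
  | store σ b i e =>
    intro a ha
    simp only [Program.Writes] at ha
    simp [ha]
  | seq _ _ ih1 ih2 => exact (ih1.mono fun _ => Or.inl).trans (ih2.mono fun _ => Or.inr)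
  | iteTrue _ _ ih => exact ih.mono fun _ => Or.inl
  | iteFalse _ _ ih => exact ih.mono fun _ => Or.inr
  | loopDone => exact fun _ _ => rfl
  | loopStep _ _ _ ih1 ih2 => exact (ih1.mono fun _ h => h).trans ih2

theorem Cond.cost_pos (b : Cond) : 0 < b.cost := by
  cases b <;> simp [Cond.cost]

/-- The loop-free programs. -/
@[simp]
def Program.LoopFree : Program → Prop
  | .seq p q => p.LoopFree ∧ q.LoopFree
  | .ite _ p q => p.LoopFree ∧ q.LoopFree
  | .loop _ _ => False
  | _ => True

open Classical in
/-- The final memory of a loop-free program. -/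
noncomputable def Program.exec : Program → Mem → Mem
  | .skip, σ => σ
  | .store a i e, σ => σ.write a (i.eval σ) (e.eval σ)
  | .seq p q, σ => q.exec (p.exec σ)
  | .ite b p q, σ => if b.Holds σ then p.exec σ else q.exec σ
  | .loop _ _, σ => σ

/-- A bound for the number of steps of a loop-free program. -/
def Program.bound : Program → ℕ
  | .skip => 1
  | .store _ i e => i.cost + e.cost + 1
  | .seq p q => p.bound + q.bound
  | .ite b p q => b.cost + p.bound + q.bound
  | .loop _ _ => 0

theorem Program.LoopFree.run {p : Program} (hp : p.LoopFree) (σ : Mem) :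
    ∃ t ≤ p.bound, Run p σ (p.exec σ) t := by
  induction p generalizing σ with
  | skip => exact ⟨1, le_rfl, .skip σ⟩
  | store a i e => exact ⟨_, le_rfl, .store σ a i e⟩
  | seq p q ihp ihq =>
    obtain ⟨t, ht, hr⟩ := ihp hp.1 σ
    obtain ⟨u, hu, hr'⟩ := ihq hp.2 (p.exec σ)
    exact ⟨t + u, add_le_add ht hu, hr.seq hr'⟩
  | ite b p q ihp ihq =>
    by_cases hb : b.Holds σ
    · obtain ⟨t, ht, hr⟩ := ihp hp.1 σ
      refine ⟨b.cost + t, by simp only [Program.bound]; omega, ?_⟩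
      rw [Program.exec, if_pos hb]
      exact .iteTrue hb hr
    · obtain ⟨t, ht, hr⟩ := ihq hp.2 σ
      refine ⟨b.cost + t, by simp only [Program.bound]; omega, ?_⟩
      rw [Program.exec, if_neg hb]
      exact .iteFalse hb hr
  | loop b p => exact hp.elim

/-- Loops terminate with their invariant, within the time given by a potential. -/
theorem exists_run_loop {b : Cond} {p : Program} (I : Mem → Prop) (φ : Mem → ℕ) {σ₀ : Mem}
    (h : ∀ σ, I σ → Framed p σ₀ σ → b.Holds σ →
      ∃ τ t, Run p σ τ t ∧ I τ ∧ b.cost + t + φ τ ≤ φ σ) (hσ₀ : I σ₀) :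
    ∃ τ t, Run (.loop b p) σ₀ τ t ∧ I τ ∧ ¬ b.Holds τ ∧ t + φ τ ≤ φ σ₀ + b.cost := by
  suffices H : ∀ k σ, φ σ = k → I σ → Framed p σ₀ σ →
      ∃ τ t, Run (.loop b p) σ τ t ∧ I τ ∧ ¬ b.Holds τ ∧ t + φ τ ≤ φ σ + b.cost from
    H _ σ₀ rfl hσ₀ (.refl p σ₀)
  intro k
  induction k using Nat.strong_induction_on with
  | _ k ih =>
    intro σ hk hI hf
    by_cases hb : b.Holds σ
    · obtain ⟨τ, t, hr, hI', ht⟩ := h σ hI hf hb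
      -- Testing the condition is never free, so the potential drops strictly and the induction is
      -- well founded.
      have hpos := b.cost_pos
      obtain ⟨υ, u, hr', hI'', hb', hu⟩ := ih (φ τ) (by omega) τ rfl hI' (hf.trans hr.framed)
      exact ⟨υ, b.cost + t + u, .loopStep hb hr hr', hI'', hb', by omega⟩
    · exact ⟨σ, b.cost, .loopDone hb, hI, hb, by omega⟩

/-- The variable number `a`: cell `0` of array `a`. -/
abbrev Expr.var (a : ℕ) : Expr := .cell a (.lit 0)

/-- Run `body` for the values `0, 1, …` of the variable `v` that are smaller than the variable
`a`. -/
def forRange (v a : ℕ) (body : Program) : Program :=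
  .seq (.store v (.lit 0) (.lit 0))
    (.loop (.lt (.var v) (.var a)) (.seq body (.store v (.lit 0) (.succ (.var v)))))

@[simp]
theorem forRange_writes {v a b : ℕ} {body : Program} :
    (forRange v a body).Writes b ↔ b = v ∨ body.Writes b := by
  simp [forRange]
  tauto

/-- The potential `φ` may depend on the memory as well as on the counter: one iteration may be
expensive if it uses up work that later iterations then save. The frame hypothesis spares the
invariant everything that the loop never writes. -/
theorem exists_run_forRange {v a N : ℕ} {body : Program} (I : ℕ → Mem → Prop) (φ : ℕ → Mem → ℕ)
    (hI : ∀ k σ x, I k σ → I k (σ.write v 0 x))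
    (hφ : ∀ k σ x, φ k (σ.write v 0 x) = φ k σ)
    (hv : ¬ body.Writes v) (ha : ¬ body.Writes a) (hav : a ≠ v) {σ₀ : Mem}
    (hN : σ₀ a 0 = N)
    (hbody : ∀ k < N, ∀ σ, I k σ → Framed (forRange v a body) σ₀ σ → σ v 0 = k →
      ∃ τ t, Run body σ τ t ∧ I (k + 1) τ ∧ t + φ (k + 1) τ ≤ φ k σ)
    (hσ₀ : I 0 σ₀) :
    ∃ τ t, Run (forRange v a body) σ₀ τ t ∧ I N τ ∧ t + φ N τ ≤ φ 0 σ₀ + 10 * (N + 1) := by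
  set σ₁ := σ₀.write v 0 0 with hσ₁
  have hrun₁ : Run (.store v (.lit 0) (.lit 0)) σ₀ σ₁ 3 := .store σ₀ v (.lit 0) (.lit 0)
  have haN : ∀ σ : Mem, Framed (.seq body (.store v (.lit 0) (.succ (.var v)))) σ₁ σ →
      σ a 0 = N := by
    intro σ hf
    rw [hf a (by simp [ha, hav]), hσ₁]
    simp [hav, hN]
  obtain ⟨τ, t, hr, ⟨hIτ, hle⟩, hb, ht⟩ := exists_run_loop
    (b := .lt (.var v) (.var a)) (p := .seq body (.store v (.lit 0) (.succ (.var v))))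
    -- The 10 steps per iteration are 5 for the test and 5 for the increment.
    (fun σ => I (σ v 0) σ ∧ σ v 0 ≤ N) (fun σ => φ (σ v 0) σ + 10 * (N - σ v 0)) (σ₀ := σ₁) (by
      rintro σ ⟨h1, h2⟩ hf hb
      have hlt : σ v 0 < N := by
        have := haN σ hf
        simp only [Cond.Holds, Expr.eval] at hb
        omega
      have hf' : Framed (forRange v a body) σ₀ σ :=
        (hrun₁.framed.mono (fun b hb => by simp_all)).trans (hf.mono (fun b hb => by
          simp only [Program.Writes] at hb
          simp only [forRange_writes]
          tauto))
      obtain ⟨τ, t, hr, hIτ, ht⟩ := hbody _ hlt σ h1 hf' rfl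
      have hτv : τ v 0 = σ v 0 := by rw [hr.framed v hv]
      have hwv : (τ.write v 0 (τ v 0 + 1)) v 0 = σ v 0 + 1 := by simp [hτv]
      refine ⟨τ.write v 0 (τ v 0 + 1), t + 5, hr.seq (.store τ v (.lit 0) (.succ (.var v))),
        ⟨?_, ?_⟩, ?_⟩
      · rw [hwv]
        exact hI _ _ _ hIτ
      · rw [hwv]
        exact hlt
      · rw [hwv, hφ]
        simp only [Cond.cost, Expr.cost]
        omega)
    (by simpa [hσ₁] using hI _ _ 0 hσ₀)
  have hfin : τ v 0 = N := by
    have := haN τ hr.framed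
    simp only [Cond.Holds, Expr.eval] at hb
    omega
  refine ⟨τ, 3 + t, hrun₁.seq hr, hfin ▸ hIτ, ?_⟩
  rw [hfin] at ht
  have : σ₁ v 0 = 0 := by simp [hσ₁]
  rw [this, hσ₁, hφ] at ht
  simp only [Cond.cost, Expr.cost] at ht
  omega

/-- Run `body` for all neighbours of the vertex in the variable `a`. The neighbour is the value of
the variable `17`; the variable `16` holds the current position in the adjacency lists. -/
def forNbrs (a : ℕ) (body : Program) : Program :=
  .seq (.store 16 (.lit 0) (.cell 2 (.var a)))
    (.loop (.lt (.var 16) (.cell 2 (.succ (.var a))))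
      (.seq (.store 17 (.lit 0) (.cell 3 (.var 16)))
        (.seq body (.store 16 (.lit 0) (.succ (.var 16))))))

@[simp]
theorem forNbrs_writes {a b : ℕ} {body : Program} :
    (forNbrs a body).Writes b ↔ b = 16 ∨ b = 17 ∨ body.Writes b := by
  simp [forNbrs]
  tauto

variable {n s : ℕ} {G : SimpleGraph (Fin n)} {L : Fin n → List (Fin n)}

/-- The input arrays are intact. -/
def HasInput (L : Fin n → List (Fin n)) (s : ℕ) (σ : Mem) : Prop :=
  ∀ a < 4, σ a = inputMem L s a

theorem take_flatten_length_succ (L : Fin n → List (Fin n)) (v : Fin n) :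
    ((List.ofFn L).take (v + 1)).flatten.length =
      ((List.ofFn L).take v).flatten.length + (L v).length := by
  rw [List.take_add_one, List.flatten_append, List.length_append]
  simp

theorem HasInput.offset_succ {σ : Mem} (h : HasInput L s σ) (v : Fin n) :
    σ 2 (v + 1) = σ 2 v + (L v).length := by
  rw [h 2 (by omega)]
  simp only [inputMem]
  rw [if_pos (by omega), if_pos (by omega), take_flatten_length_succ]

theorem HasInput.adj_apply {σ : Mem} (h : HasInput L s σ) (v : Fin n) {j : ℕ}
    (hj : j < (L v).length) : σ 3 (σ 2 v + j) = (L v)[j] := by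
  rw [h 2 (by omega), h 3 (by omega)]
  simp only [inputMem]
  rw [if_pos (by omega)]
  have : (List.ofFn L).flatten = ((List.ofFn L).take v).flatten ++ (L v ++
      ((List.ofFn L).drop (v + 1)).flatten) := by
    conv_lhs => rw [← List.take_append_drop v (List.ofFn L), List.flatten_append,
      List.drop_eq_getElem_cons (by simp), List.flatten_cons]
    simp
  rw [List.getD_eq_getElem?_getD, List.getElem?_map, this, List.getElem?_append_right (by omega),
    Nat.add_sub_cancel_left, List.getElem?_append_left hj, List.getElem?_eq_getElem hj]
  rfl

theorem IsAdjacencyList.length_eq (hL : IsAdjacencyList G L) (v : Fin n) :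
    (L v).length = #(nbr G v) := by
  rw [← List.toFinset_card_of_nodup (hL v).1]
  congr 1
  ext w
  simp [(hL v).2 w]

/-- The invariant is indexed by the set of neighbours already treated, so it does not depend on the
order of the list. Lists have no repetitions, hence each neighbour arrives as a new element and
bodies may count. -/
theorem exists_run_forNbrs {a : ℕ} {body : Program} (hL : IsAdjacencyList G L) {v : Fin n}
    (I : Finset (Fin n) → Mem → Prop)
    (hI : ∀ S σ i x, i = 16 ∨ i = 17 → I S σ → I S (σ.write i 0 x))
    (hfree : body.LoopFree) (hw : ∀ b, b < 4 ∨ b = 16 ∨ b = a → ¬ body.Writes b)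
    (ha : a ≠ 16 ∧ a ≠ 17) {σ₀ : Mem} (hin : HasInput L s σ₀) (hv : σ₀ a 0 = v)
    (hbody : ∀ S w σ, S ⊆ nbr G v → G.Adj v w → w ∉ S → I S σ →
      Framed (forNbrs a body) σ₀ σ → σ 17 0 = w → I (insert w S) (body.exec σ))
    (hσ₀ : I ∅ σ₀) :
    ∃ τ t, Run (forNbrs a body) σ₀ τ t ∧ I (nbr G v) τ ∧
      t ≤ (body.bound + 30) * (#(nbr G v) + 1) := by
  set σ₁ := σ₀.write 16 0 (σ₀ 2 (σ₀ a 0)) with hσ₁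
  have hrun₁ : Run (.store 16 (.lit 0) (.cell 2 (.var a))) σ₀ σ₁ 5 :=
    .store σ₀ 16 (.lit 0) (.cell 2 (.var a))
  set inner : Program := .seq (.store 17 (.lit 0) (.cell 3 (.var 16)))
        (.seq body (.store 16 (.lit 0) (.succ (.var 16)))) with hinner
  have hinner_writes : ∀ b, inner.Writes b ↔ b = 16 ∨ b = 17 ∨ body.Writes b := by
    intro b
    simp [hinner]
    tauto
  have hfr : ∀ σ, Framed inner σ₁ σ → Framed (forNbrs a body) σ₀ σ := by
    intro σ hf
    refine (hrun₁.framed.mono fun b hb => ?_).trans (hf.mono fun b hb => ?_)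
    · simp only [Program.Writes] at hb
      simp [hb]
    · rw [hinner_writes] at hb
      simpa using hb
  have hcons : ∀ σ, Framed inner σ₁ σ → HasInput L s σ ∧ σ a 0 = v ∧ σ 2 = σ₀ 2 := by
    intro σ hf
    have hfr' := hfr σ hf
    refine ⟨fun b hb => ?_, ?_, ?_⟩
    · rw [hfr' b (by simp [hw b (.inl hb)]; omega), hin b hb]
    · rw [hfr' a (by simp [hw a (by simp), ha]), hv]
    · rw [hfr' 2 (by simp [hw 2])]
  set o := σ₀ 2 v with ho
  have hoend : σ₀ 2 (v + 1) = o + (L v).length := hin.offset_succ v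
  have h16 : σ₁ 16 0 = o := by simp [hσ₁, hv, ho]
  obtain ⟨τ, t, hr, ⟨hle, hIτ⟩, hb, ht⟩ := exists_run_loop
    (b := .lt (.var 16) (.cell 2 (.succ (.var a)))) (p := inner)
    (fun σ => (o ≤ σ 16 0 ∧ σ 16 0 ≤ o + (L v).length) ∧
      I ((L v).take (σ 16 0 - o)).toFinset σ)
    -- Besides the body, an iteration costs 17: 7 for the test and 5 for each of the two stores.
    (fun σ => (body.bound + 20) * (o + (L v).length - σ 16 0)) (σ₀ := σ₁) (by
      rintro σ ⟨⟨h1, h2⟩, h3⟩ hf hb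
      obtain ⟨hin', hv', h2'⟩ := hcons σ hf
      have hlt : σ 16 0 < o + (L v).length := by
        simp only [Cond.Holds, Expr.eval, hv', h2', hoend] at hb
        exact hb
      set j := σ 16 0 - o with hj
      have hjlt : j < (L v).length := by omega
      have h16 : σ 16 0 = o + j := by omega
      set w := (L v)[j] with hwdef
      have hread : σ 3 (σ 16 0) = w := by
        rw [h16, ho, ← h2', hin'.adj_apply v hjlt]
      set σ' := σ.write 17 0 w with hσ'
      have hrun' : Run (.store 17 (.lit 0) (.cell 3 (.var 16))) σ σ' 5 := by
        have := Run.store σ 17 (.lit 0) (.cell 3 (.var 16))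
        simp only [Expr.eval, hread] at this
        exact this
      obtain ⟨t, ht, hrb⟩ := hfree.run σ'
      have hσ'16 : (body.exec σ') 16 0 = σ 16 0 := by
        rw [hrb.framed 16 (hw 16 (by simp)), hσ']
        simp
      have htake : ((L v).take (j + 1)).toFinset = insert w ((L v).take j).toFinset := by
        rw [List.take_add_one, List.getElem?_eq_getElem hjlt]
        ext y
        simp only [Option.toList_some, mem_insert, List.mem_toFinset, List.mem_append,
          List.mem_singleton, ← hwdef]
        tauto
      have hstep := hbody ((L v).take j).toFinset w σ'
        (fun y hy => by
          rw [List.mem_toFinset] at hy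
          simpa using ((hL v).2 y).1 (List.mem_of_mem_take hy))
        (((hL v).2 w).1 (List.getElem_mem _))
        (fun hy => by
          rw [List.mem_toFinset, List.mem_take_iff_getElem] at hy
          obtain ⟨i, hi, hiw⟩ := hy
          have := ((hL v).1.getElem_inj_iff).1 hiw
          omega)
        (hI _ _ _ _ (.inr rfl) h3)
        ((hfr σ hf).trans (hrun'.framed.mono fun b hb => by
          simp only [Program.Writes] at hb
          simp [hb]))
        (by simp [hσ'])
      refine ⟨(body.exec σ').write 16 0 ((body.exec σ') 16 0 + 1), 5 + (t + 5),
        hrun'.seq (hrb.seq (.store _ 16 (.lit 0) (.succ (.var 16)))), ⟨?_, ?_⟩, ?_⟩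
      · simp only [Mem.write_apply, if_true, Function.update_self, hσ'16]
        omega
      · have : ((body.exec σ').write 16 0 ((body.exec σ') 16 0 + 1)) 16 0 - o = j + 1 := by
          simp only [Mem.write_apply, if_true, Function.update_self, hσ'16]
          omega
        rw [this, htake]
        exact hI _ _ _ _ (.inl rfl) hstep
      · simp only [Mem.write_apply, if_true, Function.update_self, hσ'16, Cond.cost, Expr.cost]
        obtain ⟨d, hd⟩ : ∃ d, o + (L v).length - σ 16 0 = d + 1 := ⟨_, (Nat.succ_pred (by omega)).symm⟩
        rw [hd, show o + (L v).length - (σ 16 0 + 1) = d by omega, mul_add]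
        omega)
    (by
      rw [h16]
      refine ⟨by omega, ?_⟩
      simpa using hI ∅ σ₀ 16 _ (.inl rfl) hσ₀)
  obtain ⟨-, hv', h2'⟩ := hcons τ hr.framed
  have hend : τ 16 0 - o = (L v).length := by
    simp only [Cond.Holds, Expr.eval, hv', h2', hoend] at hb
    omega
  have hset : ((L v).take (τ 16 0 - o)).toFinset = nbr G v := by
    rw [hend, List.take_length]
    ext y
    simp [(hL v).2 y]
  refine ⟨τ, 5 + t, hrun₁.seq hr, hset ▸ hIτ, ?_⟩
  simp only [h16, Nat.add_sub_cancel_left, Cond.cost, Expr.cost] at ht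
  rw [← hL.length_eq]
  have e1 : (body.bound + 30) * ((L v).length + 1) =
    (body.bound + 20) * (L v).length + 10 * (L v).length + body.bound + 30 := by ring
  omega

end Machine

end StarPartition

namespace StarPartition

open Finset

/-! ## The program

Array `4` marks the vertices visited by the search, array `5` is its queue, with head and tail in
the variables `11` and `12`. Array `6` marks the vertices that have a position in the order, array
`8` holds the block of such a vertex. Array `7` holds, for any other vertex, the number of vertices
plus the number of neighbours without a position minus the number of neighbours with a position.
The variable `18` is the number of vertices in the current block, which has number `19`. Among
the candidates in a neighbourhood, the best one is in the variable `13`, and `14` tells whether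
there is any. Array `9` marks the blocks that contain a star. -/

section Algorithm

theorem Program.LoopFree.framed {p : Program} (hp : p.LoopFree) (σ : Mem) :
    Framed p σ (p.exec σ) := by
  obtain ⟨t, -, h⟩ := hp.run σ
  exact h.framed

/-- Compute the degree of every vertex, increased by the number of vertices. -/
def initKeys : Program :=
  forRange 10 0 (.seq (.store 7 (.var 10) (.var 0))
    (forNbrs 10 (.store 7 (.var 10) (.succ (.cell 7 (.var 10))))))

/-- Replace the best candidate by the current neighbour if that one is better. -/
def consider : Program :=
  .seq (.ite (.and (.not (.eq (.var 14) (.lit 0)))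
      (.not (.lt (.cell 7 (.var 17)) (.cell 7 (.var 13))))) .skip
    (.store 13 (.lit 0) (.var 17))) (.store 14 (.lit 0) (.lit 1))

/-- Mark the vertex in variable `a` as visited and enqueue it. -/
def visit (a : ℕ) : Program :=
  .seq (.store 4 (.var a) (.lit 1))
    (.seq (.store 5 (.var 12) (.var a)) (.store 12 (.lit 0) (.succ (.var 12))))

/-- Dequeue a vertex. -/
def dequeue : Program :=
  .seq (.store 15 (.lit 0) (.cell 5 (.var 11)))
    (.seq (.store 11 (.lit 0) (.succ (.var 11))) (.store 14 (.lit 0) (.lit 0)))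

/-- The treatment of a neighbour in the search. -/
def searchStep : Program :=
  .ite (.eq (.cell 4 (.var 17)) (.lit 0)) (.seq (visit 17) consider) .skip

/-- Search through a component. -/
def search : Program :=
  .loop (.lt (.var 11) (.var 12)) (.seq dequeue (forNbrs 15 searchStep))

/-- Give the next position in the order to the candidate. -/
def place : Program :=
  .seq (.store 15 (.lit 0) (.var 13)) (.seq (.store 6 (.var 15) (.lit 1))
    (.seq (.store 8 (.var 15) (.var 19)) (.ite (.eq (.var 18) (.var 1))
      (.seq (.store 19 (.lit 0) (.succ (.var 19))) (.store 18 (.lit 0) (.lit 0)))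
      (.store 18 (.lit 0) (.succ (.var 18))))))

/-- The treatment of a neighbour of the vertex placed last. -/
def peelStep : Program :=
  .ite (.eq (.cell 6 (.var 17)) (.lit 0))
    (.seq (.store 7 (.var 17) (.pred (.pred (.cell 7 (.var 17))))) consider) .skip

/-- Place the vertices of a component. -/
def peel : Program :=
  .loop (.not (.eq (.var 14) (.lit 0)))
    (.seq (.seq place (.store 14 (.lit 0) (.lit 0))) (forNbrs 15 peelStep))

/-- Compute the blocks of an umbrella order. -/
def computeBlocks : Program :=
  forRange 10 0 (.ite (.eq (.cell 4 (.var 10)) (.lit 0))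
    (.seq (.seq (visit 10) (.store 13 (.lit 0) (.var 10)))
      (.seq search (.seq (.store 14 (.lit 0) (.lit 1)) peel))) .skip)

/-- Mark the blocks that contain a star. -/
def markStars : Program :=
  forRange 10 0 (.seq (.store 20 (.lit 0) (.lit 0))
    (.seq (forNbrs 10 (.ite (.eq (.cell 8 (.var 17)) (.cell 8 (.var 10)))
        (.store 20 (.lit 0) (.succ (.var 20))) .skip))
      (.ite (.eq (.var 20) (.var 1)) (.store 9 (.cell 8 (.var 10)) (.lit 1)) .skip)))

/-- Check that all blocks are complete and contain a star. -/
def decideBlocks : Program :=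
  .seq (.ite (.eq (.var 18) (.lit 0)) (.store 0 (.lit 0) (.lit 1)) (.store 0 (.lit 0) (.lit 0)))
    (forRange 10 19 (.ite (.eq (.cell 9 (.var 10)) (.lit 0)) (.store 0 (.lit 0) (.lit 0)) .skip))

/-- The algorithm for star partitions of unit interval graphs. -/
def starPartitionProgram : Program :=
  .seq initKeys (.seq computeBlocks (.seq markStars decideBlocks))

/-! ### Passes over all vertices and their cost -/

variable {n s : ℕ} {G : SimpleGraph (Fin n)} {L : Fin n → List (Fin n)}

theorem HasInput.of_framed {σ τ : Mem} {p : Program} (h : HasInput L s σ) (hf : Framed p σ τ)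
    (hp : ∀ a < 4, ¬ p.Writes a) : HasInput L s τ := fun a ha => (hf a (hp a ha)).trans (h a ha)

theorem HasInput.apply_zero {σ : Mem} (h : HasInput L s σ) : σ 0 0 = n := by
  rw [h 0 (by omega)]; rfl

theorem HasInput.apply_one {σ : Mem} (h : HasInput L s σ) : σ 1 0 = s := by
  rw [h 1 (by omega)]; rfl

/-- The total size of the closed neighbourhoods of the vertices in `S`. -/
noncomputable def weight (G : SimpleGraph (Fin n)) (S : Finset (Fin n)) : ℕ :=
  ∑ v ∈ S, (#(nbr G v) + 1)

theorem weight_univ (G : SimpleGraph (Fin n)) : weight G univ = 2 * G.edgeSet.ncard + n := by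
  simp [weight, sum_add_distrib, sum_card_nbr]

theorem weight_le_univ (S : Finset (Fin n)) : weight G S ≤ weight G univ :=
  sum_le_sum_of_subset (subset_univ S)

theorem weight_compl_insert {S : Finset (Fin n)} {v : Fin n} (hv : v ∉ S) :
    weight G Sᶜ = weight G (insert v S)ᶜ + (#(nbr G v) + 1) := by
  rw [weight, weight, compl_insert, sum_erase_add _ _ (by simpa using hv)]

/-- The potential is the weight of the vertices not yet reached by the counter, so a body of cost
`O(deg + 1)` gives a pass of cost `O(n + m)`. -/
theorem exists_run_forRange_vertex {body : Program} (K : ℕ) (I : ℕ → Mem → Prop)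
    (hI : ∀ k σ x, I k σ → I k (σ.write 10 0 x)) (hw : ∀ b, b < 4 ∨ b = 10 → ¬ body.Writes b)
    {σ₀ : Mem} (hin : HasInput L s σ₀)
    (hbody : ∀ (v : Fin n) σ, I v σ → Framed (forRange 10 0 body) σ₀ σ → HasInput L s σ →
      σ 10 0 = v → ∃ τ t, Run body σ τ t ∧ I (v + 1) τ ∧ t ≤ K * (#(nbr G v) + 1))
    (hσ₀ : I 0 σ₀) :
    ∃ τ t, Run (forRange 10 0 body) σ₀ τ t ∧ I n τ ∧ t ≤ K * weight G univ + 10 * (n + 1) := by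
  obtain ⟨τ, t, hr, hIτ, ht⟩ := exists_run_forRange (v := 10) (a := 0) (N := n) (body := body) I
    (fun k _ => K * weight G ({v : Fin n | (v : ℕ) < k} : Finset (Fin n))ᶜ) hI (fun _ _ _ => rfl)
    (hw 10 (by simp)) (hw 0 (by simp)) (by simp) hin.apply_zero (by
      intro k hk σ hσ hf hv
      obtain ⟨τ, t, hr, hIτ, ht⟩ := hbody ⟨k, hk⟩ σ hσ hf
        (hin.of_framed hf fun b hb => by simp [hw b (.inl hb)]; omega) hv
      refine ⟨τ, t, hr, hIτ, ?_⟩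
      have : ({v : Fin n | (v : ℕ) < k + 1} : Finset (Fin n)) =
          insert ⟨k, hk⟩ ({v : Fin n | (v : ℕ) < k} : Finset (Fin n)) := by
        ext v
        simp only [mem_filter, mem_univ, true_and, mem_insert, Fin.ext_iff]
        omega
      simp only [this]
      rw [weight_compl_insert (S := {v : Fin n | (v : ℕ) < k}) (v := ⟨k, hk⟩) (by simp), mul_add]
      omega) hσ₀
  refine ⟨τ, t, hr, hIτ, ?_⟩
  have := Nat.mul_le_mul_left K
    (weight_le_univ (G := G) ({v : Fin n | (v : ℕ) < 0} : Finset (Fin n))ᶜ)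
  omega

theorem exists_run_initKeys (hL : IsAdjacencyList G L) {σ₀ : Mem} (hin : HasInput L s σ₀) :
    ∃ τ t, Run initKeys σ₀ τ t ∧ (∀ v : Fin n, τ 7 v = n + #(nbr G v)) ∧
      t ≤ 50 * weight G univ + 10 * (n + 1) := by
  have hw : ∀ b, b < 4 ∨ b = 10 → ¬ (Program.seq (.store 7 (.var 10) (.var 0))
    (forNbrs 10 (.store 7 (.var 10) (.succ (.cell 7 (.var 10)))))).Writes b := by
    intro b hb
    simp
    omega
  obtain ⟨τ, t, hr, hI, ht⟩ := exists_run_forRange_vertex (G := G) 50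
    (fun k σ => ∀ v : Fin n, (v : ℕ) < k → σ 7 v = n + #(nbr G v)) (by simp) hw hin (by
      intro v σ hσ _ hin' hv
      set σ₁ := σ.write 7 v n with hσ₁
      have hrun : Run (.store 7 (.var 10) (.var 0)) σ σ₁ 5 := by
        have := Run.store σ 7 (.var 10) (.var 0)
        simp only [Expr.eval, hv, hin'.apply_zero] at this
        exact this
      obtain ⟨τ, t, hr, hI, ht⟩ := exists_run_forNbrs (a := 10) hL (v := v)
        (body := .store 7 (.var 10) (.succ (.cell 7 (.var 10))))
        (fun S τ => τ 7 v = n + #S ∧ ∀ u, u ≠ v → τ 7 u = σ 7 (u : Fin n))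
        (by rintro S σ i x (rfl | rfl) h <;> simpa using h) (by simp)
        (by intro b hb; simp; omega) (by simp)
        (hin'.of_framed hrun.framed (by intro b hb; simp; omega))
        (by simpa [hσ₁] using hv) (by
          rintro S w τ - - hwS ⟨h1, h2⟩ hf -
          have h10 : τ 10 0 = v := by rw [hf 10 (by simp)]; simpa [hσ₁] using hv
          simp only [Program.exec, Expr.eval, h10, Mem.write_apply, if_true, Function.update_self,
            card_insert_of_notMem hwS, h1]
          refine ⟨by omega, fun u hu => ?_⟩
          rw [Function.update_of_ne (fun h => hu (Fin.ext h)), h2 u hu])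
        (by
          refine ⟨by simp [hσ₁], fun u hu => ?_⟩
          simp only [hσ₁, Mem.write_apply, if_true]
          rw [Function.update_of_ne (fun h => hu (Fin.ext h))])
      refine ⟨τ, 5 + t, hrun.seq hr, fun u hu => ?_, ?_⟩
      · rcases eq_or_ne u v with rfl | huv
        · exact hI.1
        · rw [hI.2 u huv]
          exact hσ u (by have := Fin.val_ne_of_ne huv; omega)
      · simp only [Program.bound, Expr.cost] at ht
        omega) (by simp)
  exact ⟨τ, t, hr, fun v => hI v v.2, ht⟩

theorem exists_run_markStars (hL : IsAdjacencyList G L) {σ₀ : Mem} (hin : HasInput L s σ₀)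
    (h9 : ∀ b, σ₀ 9 b = 0) :
    ∃ τ t, Run markStars σ₀ τ t ∧
      (∀ b, τ 9 b ≠ 0 ↔ ∃ v : Fin n, σ₀ 8 v = b ∧ #{w ∈ nbr G v | σ₀ 8 (w : Fin n) = σ₀ 8 v} = s) ∧
      t ≤ 70 * weight G univ + 10 * (n + 1) := by
  obtain ⟨τ, t, hr, hI, ht⟩ := exists_run_forRange_vertex (G := G) 70
    (fun k σ => ∀ b, σ 9 b ≠ 0 ↔
      ∃ v : Fin n, (v : ℕ) < k ∧ σ₀ 8 v = b ∧ #{w ∈ nbr G v | σ₀ 8 (w : Fin n) = σ₀ 8 v} = s)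
    (by simp) (body := .seq (.store 20 (.lit 0) (.lit 0))
    (.seq (forNbrs 10 (.ite (.eq (.cell 8 (.var 17)) (.cell 8 (.var 10)))
        (.store 20 (.lit 0) (.succ (.var 20))) .skip))
      (.ite (.eq (.var 20) (.var 1)) (.store 9 (.cell 8 (.var 10)) (.lit 1)) .skip)))
    (by intro b hb; simp; omega) hin (by
      intro v σ hσ hfσ hin' hv
      have h8 : σ 8 = σ₀ 8 := hfσ 8 (by simp)
      have hrun : Run (.store 20 (.lit 0) (.lit 0)) σ (σ.write 20 0 0) 3 :=
        .store σ 20 (.lit 0) (.lit 0)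
      obtain ⟨τ, t, hr, hI, ht⟩ := exists_run_forNbrs (a := 10) hL (v := v)
        (body := .ite (.eq (.cell 8 (.var 17)) (.cell 8 (.var 10)))
          (.store 20 (.lit 0) (.succ (.var 20))) .skip)
        (fun S τ => τ 20 0 = #{w ∈ S | σ₀ 8 (w : Fin n) = σ₀ 8 v})
        (by rintro S σ i x (rfl | rfl) h <;> simpa using h) (by simp)
        (by intro b hb; simp; omega) (by simp)
        (hin'.of_framed hrun.framed (by intro b hb; simp; omega))
        (by simpa using hv) (by
          rintro S w τ - - hwS h1 hf h17
          have h10 : τ 10 0 = v := by rw [hf 10 (by simp)]; simpa using hv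
          have h8' : τ 8 = σ₀ 8 := by rw [hf 8 (by simp)]; simpa using h8
          have hc : (Cond.eq (.cell 8 (.var 17)) (.cell 8 (.var 10))).Holds τ ↔
              σ₀ 8 w = σ₀ 8 v := by simp [Cond.Holds, Expr.eval, h10, h17, h8']
          simp only [Program.exec, hc, filter_insert]
          split_ifs
          · rw [card_insert_of_notMem (by simp [hwS]), ← h1]
            simp [Expr.eval]
          · exact h1)
        (by simp)
      set fin : Program := .ite (.eq (.var 20) (.var 1)) (.store 9 (.cell 8 (.var 10)) (.lit 1)) .skip
        with hfin
      obtain ⟨u, hu, hru⟩ := Program.LoopFree.run (p := fin) (by simp [hfin]) τ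
      have h10 : τ 10 0 = v := by rw [hr.framed 10 (by simp)]; simpa using hv
      have h8' : τ 8 = σ₀ 8 := by rw [hr.framed 8 (by simp)]; simpa using h8
      have h9' : τ 9 = σ 9 := by rw [hr.framed 9 (by simp)]; simp
      have h1' : τ 1 0 = s := by rw [hr.framed 1 (by simp)]; simpa using hin'.apply_one
      refine ⟨fin.exec τ, 3 + (t + u), hrun.seq (hr.seq hru), fun b => ?_, ?_⟩
      · have hsplit : (∃ u : Fin n, (u : ℕ) < v + 1 ∧ σ₀ 8 u = b ∧
            #{w ∈ nbr G u | σ₀ 8 (w : Fin n) = σ₀ 8 u} = s) ↔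
            (σ₀ 8 v = b ∧ #{w ∈ nbr G v | σ₀ 8 (w : Fin n) = σ₀ 8 v} = s) ∨ ∃ u : Fin n, (u : ℕ) < v ∧
            σ₀ 8 u = b ∧ #{w ∈ nbr G u | σ₀ 8 (w : Fin n) = σ₀ 8 u} = s := by
          constructor
          · rintro ⟨u, hu, h⟩
            rcases (Nat.lt_succ_iff_lt_or_eq.1 hu) with h' | h'
            · exact .inr ⟨u, h', h⟩
            · exact .inl (Fin.ext h' ▸ h)
          · rintro (h | ⟨u, hu, h⟩)
            · exact ⟨v, by omega, h⟩
            · exact ⟨u, by omega, h⟩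
        rw [hsplit, ← hσ b]
        have hc : (Cond.eq (.var 20) (.var 1)).Holds τ ↔
            #{w ∈ nbr G v | σ₀ 8 (w : Fin n) = σ₀ 8 v} = s := by
          simp [Cond.Holds, Expr.eval, hI, h1']
        simp only [hfin, Program.exec, hc]
        split_ifs with hs
        · simp only [Expr.eval, h10, h8', Mem.write_apply, if_true, h9', Function.update_apply, hs, and_true]
          split_ifs with hb
          · simp [hb]
          · have : ¬ σ₀ 8 v = b := fun h => hb h.symm
            simp [this]
        · simp [hs, h9']
      · simp only [hfin, Program.bound, Cond.cost, Expr.cost] at ht hu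
        omega) (by simp [h9])
  exact ⟨τ, t, hr, fun b => by rw [hI b]; simp, ht⟩

/-- The output cell is the one that held `n`, which is no longer needed: the loop runs over the
number of complete blocks, in variable `19`. -/
theorem exists_run_decideBlocks (σ₀ : Mem) :
    ∃ τ t, Run decideBlocks σ₀ τ t ∧
      τ 0 0 = (open Classical in
        if σ₀ 18 0 = 0 ∧ ∀ b < σ₀ 19 0, σ₀ 9 b ≠ 0 then 1 else 0) ∧
      t ≤ 30 * (σ₀ 19 0 + 1) := by
  classical
  set first : Program := .ite (.eq (.var 18) (.lit 0)) (.store 0 (.lit 0) (.lit 1))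
    (.store 0 (.lit 0) (.lit 0)) with hfirst
  obtain ⟨u, hu, hru⟩ := Program.LoopFree.run (p := first) (by simp [hfirst]) σ₀
  set σ₁ := first.exec σ₀ with hσ₁
  set body : Program := .ite (.eq (.cell 9 (.var 10)) (.lit 0)) (.store 0 (.lit 0) (.lit 0)) .skip
    with hbody
  have h9 : σ₁ 9 = σ₀ 9 := hru.framed 9 (by simp [hfirst])
  have h19 : σ₁ 19 = σ₀ 19 := hru.framed 19 (by simp [hfirst])
  obtain ⟨τ, t, hr, hI, ht⟩ := exists_run_forRange (v := 10) (a := 19) (N := σ₀ 19 0) (body := body)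
    (fun k σ => σ 0 0 = if σ₀ 18 0 = 0 ∧ ∀ b < k, σ₀ 9 b ≠ 0 then 1 else 0)
    (fun k _ => 15 * (σ₀ 19 0 - k)) (by simp) (fun _ _ _ => rfl) (by simp [hbody])
    (by simp [hbody]) (by simp) (σ₀ := σ₁) (by rw [h19]) (by
      intro k hk σ hσ hf hv
      obtain ⟨t, ht, hrt⟩ := Program.LoopFree.run (p := body) (by simp [hbody]) σ
      have h9' : σ 9 = σ₀ 9 := by rw [hf 9 (by simp [hbody]), h9]
      refine ⟨_, t, hrt, ?_, ?_⟩
      · have hc : (Cond.eq (.cell 9 (.var 10)) (.lit 0)).Holds σ ↔ σ₀ 9 k = 0 := by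
          simp [Cond.Holds, Expr.eval, hv, h9']
        simp only [hbody, Program.exec, hc]
        split_ifs with h0 h1 h1
        · exact absurd h0 (h1.2 k (by omega))
        · simp [Expr.eval]
        · rw [hσ, if_pos ⟨h1.1, fun b hb => h1.2 b (by omega)⟩]
        · rw [hσ, if_neg]
          rintro ⟨h2, h3⟩
          refine h1 ⟨h2, fun b hb => ?_⟩
          rcases Nat.lt_succ_iff_lt_or_eq.1 hb with h | rfl
          · exact h3 b h
          · exact h0
      · simp only [hbody, Program.bound, Cond.cost, Expr.cost] at ht
        omega) (by
      simp only [hσ₁, hfirst, Program.exec, Cond.Holds, Expr.eval]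
      split_ifs <;> simp_all)
  refine ⟨τ, u + t, hru.seq hr, hI, ?_⟩
  simp only [hfirst, Program.bound, Cond.cost, Expr.cost] at hu
  omega

end Algorithm

end StarPartition

namespace StarPartition

open Finset

/-! ### Minimum keys and marked vertices -/

section Candidates

variable {n s : ℕ} {G : SimpleGraph (Fin n)} {L : Fin n → List (Fin n)}

/-- The candidate variables describe an element of `T` with minimum key. If `T` is empty, the
candidate is still `c₀`. -/
def IsBest (T : Finset (Fin n)) (c₀ : ℕ) (σ : Mem) : Prop :=
  (σ 14 0 = 0 ∧ T = ∅ ∧ σ 13 0 = c₀) ∨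
    (σ 14 0 ≠ 0 ∧ ∃ c ∈ T, σ 13 0 = c ∧ ∀ y ∈ T, σ 7 c ≤ σ 7 (y : Fin n))

/-- Only keys inside `T` have to agree: the key of a vertex may be changed just before the vertex
joins `T`. -/
theorem IsBest.congr {T : Finset (Fin n)} {c₀ : ℕ} {σ τ : Mem} (h : IsBest T c₀ σ)
    (h13 : τ 13 = σ 13) (h14 : τ 14 = σ 14) (h7 : ∀ y ∈ T, τ 7 (y : Fin n) = σ 7 y) :
    IsBest T c₀ τ := by
  rw [IsBest, h13, h14]
  refine h.imp id fun ⟨h1, c, hc, h2, h3⟩ => ⟨h1, c, hc, h2, fun y hy => ?_⟩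
  rw [h7 c hc, h7 y hy]
  exact h3 y hy

theorem IsBest.consider {T : Finset (Fin n)} {c₀ : ℕ} {σ : Mem} (h : IsBest T c₀ σ) {w : Fin n}
    (hw : σ 17 0 = w) : IsBest (insert w T) c₀ (consider.exec σ) := by
  right
  have hc : (Cond.and (.not (.eq (.var 14) (.lit 0)))
      (.not (.lt (.cell 7 (.var 17)) (.cell 7 (.var 13))))).Holds σ ↔
      σ 14 0 ≠ 0 ∧ ¬ σ 7 w < σ 7 (σ 13 0) := by
    simp [Cond.Holds, Expr.eval, hw]
  simp only [StarPartition.consider, Program.exec, hc]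
  split_ifs with hcond
  · refine ⟨by simp [Expr.eval], ?_⟩
    obtain ⟨h1, -, -⟩ | ⟨-, c, hc, h2, h3⟩ := h
    · exact absurd h1 hcond.1
    refine ⟨c, mem_insert_of_mem hc, by simpa using h2, fun y hy => ?_⟩
    rw [h2] at hcond
    rcases mem_insert.1 hy with rfl | hy
    · simpa using hcond.2
    · simpa using h3 y hy
  · refine ⟨by simp [Expr.eval], w, mem_insert_self w T, by simp [Expr.eval, hw], fun y hy => ?_⟩
    rcases mem_insert.1 hy with rfl | hy
    · exact le_rfl
    obtain ⟨-, rfl, -⟩ | ⟨h1, c, hc, h2, h3⟩ := h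
    · simp at hy
    · rw [h2] at hcond
      have := h3 y hy
      simp only [Mem.write_apply]
      norm_num
      have : σ 7 w < σ 7 c := by
        by_contra h'
        exact hcond ⟨h1, h'⟩
      omega

/-- The vertices marked in array `a`. -/
def marked (n : ℕ) (σ : Mem) (a : ℕ) : Finset (Fin n) := {v | σ a v ≠ 0}

@[simp]
theorem mem_marked {σ : Mem} {a : ℕ} {v : Fin n} : v ∈ marked n σ a ↔ σ a v ≠ 0 := by
  simp [marked]

theorem marked_congr {σ τ : Mem} {a : ℕ} (h : τ a = σ a) : marked n τ a = marked n σ a := by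
  simp [marked, h]

theorem marked_of_eq_update {σ τ : Mem} {a : ℕ} {v : Fin n}
    (h : τ a = Function.update (σ a) v 1) : marked n τ a = insert v (marked n σ a) := by
  ext u
  simp only [mem_marked, h, mem_insert, Function.update_apply, Fin.val_inj]
  split_ifs with h <;> simp [h]

end Candidates

/-! ### Breadth-first search of a component -/

section Search

variable {n s : ℕ} {G : SimpleGraph (Fin n)} {L : Fin n → List (Fin n)}

/-- The visited vertices are in the queue. -/
structure IsQueue (n : ℕ) (σ : Mem) : Prop where
  le : σ 11 0 ≤ σ 12 0
  lt : ∀ j < σ 12 0, σ 5 j < n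
  inj : ∀ i j, i < j → j < σ 12 0 → σ 5 i ≠ σ 5 j
  mem : ∀ v : Fin n, v ∈ marked n σ 4 ↔ ∃ j < σ 12 0, σ 5 j = v

theorem IsQueue.congr {σ τ : Mem} (h : IsQueue n σ) (h4 : τ 4 = σ 4) (h5 : τ 5 = σ 5)
    (h11 : τ 11 = σ 11) (h12 : τ 12 = σ 12) : IsQueue n τ := by
  refine ⟨by rw [h11, h12]; exact h.le, by rw [h5, h12]; exact h.lt, by rw [h5, h12]; exact h.inj,
    by rw [marked_congr h4, h5, h12]; exact h.mem⟩

/-- The vertices that have left the queue. -/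
def processed (n : ℕ) (σ : Mem) : Finset (Fin n) := {v | ∃ j < σ 11 0, σ 5 j = v}

theorem mem_processed {σ : Mem} {v : Fin n} : v ∈ processed n σ ↔ ∃ j < σ 11 0, σ 5 j = v := by
  simp [processed]

theorem IsQueue.processed_eq {σ : Mem} (h : IsQueue n σ) (heq : σ 11 0 = σ 12 0) :
    processed n σ = marked n σ 4 := by
  ext v
  rw [mem_processed, h.mem, heq]

theorem visit_exec {a : ℕ} (ha : a ≠ 4 ∧ a ≠ 5 ∧ a ≠ 12) (σ : Mem) :
    (visit a).exec σ =
      ((σ.write 4 (σ a 0) 1).write 5 (σ 12 0) (σ a 0)).write 12 0 (σ 12 0 + 1) := by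
  simp [visit, Program.exec, Expr.eval, ha]

theorem IsQueue.visit {σ : Mem} (h : IsQueue n σ) {a : ℕ} (ha : a ≠ 4 ∧ a ≠ 5 ∧ a ≠ 12)
    {w : Fin n} (hw : σ a 0 = w) (hw4 : w ∉ marked n σ 4) :
    IsQueue n ((visit a).exec σ) ∧
      marked n ((visit a).exec σ) 4 = insert w (marked n σ 4) ∧
      (visit a).exec σ 12 0 = σ 12 0 + 1 ∧
      ∀ j < σ 12 0, (visit a).exec σ 5 j = σ 5 j := by
  rw [visit_exec ha, hw]
  set τ := ((σ.write 4 w 1).write 5 (σ 12 0) w).write 12 0 (σ 12 0 + 1) with hτ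
  have h4 : τ 4 = Function.update (σ 4) w 1 := by simp [hτ]
  have h5 : τ 5 = Function.update (σ 5) (σ 12 0) w := by simp [hτ]
  have h11 : τ 11 = σ 11 := by simp [hτ]
  have h12 : τ 12 0 = σ 12 0 + 1 := by simp [hτ]
  have hold : ∀ j < σ 12 0, τ 5 j = σ 5 j := fun j hj => by
    rw [h5, Function.update_of_ne hj.ne]
  have hnew : τ 5 (σ 12 0) = w := by rw [h5, Function.update_self]
  have hm := marked_of_eq_update h4
  refine ⟨⟨?_, ?_, ?_, ?_⟩, hm, h12, hold⟩
  · have := h.le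
    rw [h11, h12]
    omega
  · intro j hj
    rw [h12] at hj
    rcases Nat.lt_succ_iff_lt_or_eq.1 hj with hj | rfl
    · rw [hold j hj]
      exact h.lt j hj
    · rw [hnew]
      exact w.2
  · intro i j hij hj
    rw [h12] at hj
    rcases Nat.lt_succ_iff_lt_or_eq.1 hj with hj | rfl
    · rw [hold j hj, hold i (hij.trans hj)]
      exact h.inj i j hij hj
    · rw [hnew, hold i hij]
      exact fun h' => hw4 ((h.mem w).2 ⟨i, hij, h'⟩)
  · intro v
    rw [hm, mem_insert, h.mem, h12]
    constructor
    · rintro (rfl | ⟨j, hj, hv⟩)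
      · exact ⟨σ 12 0, by omega, hnew⟩
      · exact ⟨j, by omega, (hold j hj).trans hv⟩
    · rintro ⟨j, hj, hv⟩
      rcases Nat.lt_succ_iff_lt_or_eq.1 hj with hj | rfl
      · exact .inr ⟨j, hj, (hold j hj).symm.trans hv⟩
      · exact .inl (Fin.ext (hv.symm.trans hnew))

/-- The invariant of the search through the component of `r`, if the vertices in `D` have been
visited before. -/
structure SearchInv (G : SimpleGraph (Fin n)) (x : Fin n ≃ Fin n) (D : Finset (Fin n)) (r : Fin n)
    (σ : Mem) : Prop where
  queue : IsQueue n σ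
  sub : D ⊆ processed n σ
  root : r ∈ marked n σ 4 \ D
  convex : IsConvex x (marked n σ 4 \ D)
  reach : ∀ v ∈ marked n σ 4 \ D, G.Reachable r v
  closed : ∀ v ∈ processed n σ, ∀ w, G.Adj v w → w ∈ marked n σ 4
  cand : ∃ c : Fin n, σ 13 0 = c ∧ IsLastBatchMin G x (marked n σ 4 \ D) c

/-- The order `x` stays fixed here and serves only to express convexity. Each vertex leaves the
queue once, and its closed neighbourhood then leaves the potential. -/
theorem exists_run_search (hL : IsAdjacencyList G L) {x : Fin n ≃ Fin n} (hx : IsUmbrella G x)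
    {D : Finset (Fin n)} (hD : IsAdjClosed G D) {r : Fin n} {σ₀ : Mem} (hin : HasInput L s σ₀)
    (hkey : ∀ v ∉ D, σ₀ 7 (v : Fin n) = n + #(nbr G v)) (hσ₀ : SearchInv G x D r σ₀) :
    ∃ τ t, Run search σ₀ τ t ∧ SearchInv G x D r τ ∧ τ 11 0 = τ 12 0 ∧
      t + 100 * weight G (processed n τ)ᶜ ≤ 100 * weight G (processed n σ₀)ᶜ + 5 := by
  obtain ⟨τ, t, hr, hI, hb, ht⟩ := exists_run_loop (b := .lt (.var 11) (.var 12))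
    (p := .seq dequeue (forNbrs 15 searchStep)) (SearchInv G x D r)
    (fun σ => 100 * weight G (processed n σ)ᶜ) (σ₀ := σ₀) (by
      intro σ hσ hfσ hb
      have hlt : σ 11 0 < σ 12 0 := hb
      have hq := hσ.queue
      obtain ⟨u, hu⟩ : ∃ u : Fin n, σ 5 (σ 11 0) = u := ⟨⟨_, hq.lt _ hlt⟩, rfl⟩
      have hu4 : u ∈ marked n σ 4 := (hq.mem u).2 ⟨_, hlt, hu⟩
      have hup : u ∉ processed n σ := by
        intro h
        obtain ⟨j, hj, hju⟩ := mem_processed.1 h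
        exact hq.inj _ _ hj hlt (hju.trans hu.symm)
      have huD : u ∉ D := fun h => hup (hσ.sub h)
      obtain ⟨t₁, ht₁, hr₁⟩ := Program.LoopFree.run (p := dequeue) (by simp [dequeue]) σ
      set σ₁ := dequeue.exec σ with hσ₁
      have h4₁ : σ₁ 4 = σ 4 := hr₁.framed 4 (by simp [dequeue])
      have h5₁ : σ₁ 5 = σ 5 := hr₁.framed 5 (by simp [dequeue])
      have h12₁ : σ₁ 12 = σ 12 := hr₁.framed 12 (by simp [dequeue])
      have h13₁ : σ₁ 13 = σ 13 := hr₁.framed 13 (by simp [dequeue])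
      have h15₁ : σ₁ 15 0 = u := by simp [hσ₁, dequeue, Program.exec, Expr.eval, hu]
      have h11₁ : σ₁ 11 0 = σ 11 0 + 1 := by simp [hσ₁, dequeue, Program.exec, Expr.eval]
      have h14₁ : σ₁ 14 0 = 0 := by simp [hσ₁, dequeue, Program.exec, Expr.eval]
      have hq₁ : IsQueue n σ₁ := by
        refine ⟨by rw [h11₁, h12₁]; exact hlt, by rw [h5₁, h12₁]; exact hq.lt,
          by rw [h5₁, h12₁]; exact hq.inj, by rw [marked_congr h4₁, h5₁, h12₁]; exact hq.mem⟩
      have hin₁ : HasInput L s σ₁ := (hin.of_framed hfσ (by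
        intro a ha
        simp [dequeue, searchStep, visit, consider]
        omega)).of_framed hr₁.framed (by intro a ha; simp [dequeue]; omega)
      obtain ⟨τ, t₂, hr₂, ⟨hqτ, hmτ, hleτ, hoτ, hbτ⟩, ht₂⟩ := exists_run_forNbrs (a := 15) hL
        (v := u) (body := searchStep)
        -- The candidates are the vertices first reached from `u`. As long as there are none, the
        -- candidate of an earlier batch survives, since dequeuing resets only the flag `14`.
        (fun S τ => IsQueue n τ ∧ marked n τ 4 = marked n σ 4 ∪ S ∧ σ₁ 12 0 ≤ τ 12 0 ∧
          (∀ j < σ₁ 12 0, τ 5 j = σ 5 j) ∧ IsBest (S \ marked n σ 4) (σ 13 0) τ)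
        (by
          rintro S τ i y hi ⟨h1, h2, h3, h4, h5⟩
          have hne : ∀ b < 16, (τ.write i 0 y) b = τ b := by
            intro b hb
            rw [Mem.write_apply, if_neg (by omega)]
          refine ⟨h1.congr (hne _ (by simp)) (hne _ (by simp)) (hne _ (by simp)) (hne _ (by simp)),
            ?_, ?_, ?_, h5.congr (hne _ (by simp)) (hne _ (by simp)) fun _ _ => ?_⟩
          · rw [marked_congr (hne 4 (by simp)), h2]
          · rw [hne 12 (by simp)]; exact h3
          · rw [hne 5 (by simp)]; exact h4
          · rw [hne 7 (by simp)])
        (by simp [searchStep, visit, consider])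
        (by intro b hb; simp [searchStep, visit, consider]; omega) (by simp) hin₁ h15₁ (by
          rintro S w τ - - hwS ⟨h1, h2, h3, h4, h5⟩ hf h17
          have hc : (Cond.eq (.cell 4 (.var 17)) (.lit 0)).Holds τ ↔ w ∉ marked n τ 4 := by
            simp [Cond.Holds, Expr.eval, h17]
          simp only [searchStep, Program.exec, hc]
          by_cases hw : w ∉ marked n τ 4
          · rw [if_pos hw]
            obtain ⟨hq', hm', h12', ho'⟩ := h1.visit (a := 17) (by simp) h17 hw
            have hfv : Framed (visit 17) τ ((visit 17).exec τ) :=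
              Program.LoopFree.framed (by simp [visit]) τ
            have hfc : Framed consider ((visit 17).exec τ)
                (consider.exec ((visit 17).exec τ)) :=
              Program.LoopFree.framed (by simp [consider]) _
            have hwσ : w ∉ marked n σ 4 := fun h => hw (h2 ▸ mem_union_left _ h)
            refine ⟨hq'.congr (hfc _ (by simp [consider])) (hfc _ (by simp [consider]))
              (hfc _ (by simp [consider])) (hfc _ (by simp [consider])), ?_, ?_, ?_, ?_⟩
            · rw [marked_congr (hfc 4 (by simp [consider])), hm', h2, union_insert]
            · rw [hfc 12 (by simp [consider]), h12']
              omega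
            · intro j hj
              rw [hfc 5 (by simp [consider]), ho' j (by omega), h4 j hj]
            · rw [insert_sdiff_of_notMem _ hwσ]
              refine (h5.congr (hfv 13 (by simp [visit])) (hfv 14 (by simp [visit]))
                fun y _ => by rw [hfv 7 (by simp [visit])]).consider ?_
              rw [hfv 17 (by simp [visit]), h17]
          · rw [if_neg hw]
            have hwσ : w ∈ marked n σ 4 := by
              rw [not_not, h2, mem_union] at hw
              exact hw.resolve_right hwS
            refine ⟨h1, ?_, h3, h4, ?_⟩
            · rw [h2, union_insert, insert_eq_of_mem (mem_union_left _ hwσ)]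
            · rwa [insert_sdiff_of_mem _ hwσ])
        ⟨hq₁, by rw [marked_congr h4₁, union_empty], le_rfl, fun j _ => by rw [h5₁],
          .inl ⟨h14₁, by simp, by rw [h13₁]⟩⟩
      have h11τ : τ 11 0 = σ 11 0 + 1 := by
        rw [hr₂.framed 11 (by simp [searchStep, visit, consider]), h11₁]
      have h7τ : τ 7 = σ₀ 7 := by
        rw [hr₂.framed 7 (by simp [searchStep, visit, consider]),
          hr₁.framed 7 (by simp [dequeue]), hfσ 7 (by simp [dequeue, searchStep, visit, consider])]
      have hpτ : processed n τ = insert u (processed n σ) := by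
        ext v
        rw [mem_insert, mem_processed, mem_processed, h11τ]
        have hoτ' : ∀ j < σ 11 0 + 1, τ 5 j = σ 5 j := fun j hj => hoτ j (by rw [h12₁]; omega)
        constructor
        · rintro ⟨j, hj, hv⟩
          rw [hoτ' j hj] at hv
          rcases Nat.lt_succ_iff_lt_or_eq.1 hj with hj | rfl
          · exact .inr ⟨j, hj, hv⟩
          · exact .inl (Fin.ext (hv.symm.trans hu))
        · rintro (rfl | ⟨j, hj, hv⟩)
          · exact ⟨σ 11 0, by omega, (hoτ' _ (by omega)).trans hu⟩
          · exact ⟨j, by omega, (hoτ' _ (by omega)).trans hv⟩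
      -- `D` is a union of components, so the search never runs back into it.
      have hnD : ∀ v ∈ nbr G u, v ∉ D := fun v hv hvD =>
        huD (hD v hvD u (mem_nbr.1 hv).symm)
      have hF : marked n τ 4 \ D = (marked n σ 4 \ D) ∪ nbr G u := by
        rw [hmτ, union_sdiff_distrib, sdiff_eq_self_of_disjoint (disjoint_left.2 hnD)]
      have huF : u ∈ marked n σ 4 \ D := mem_sdiff.2 ⟨hu4, huD⟩
      refine ⟨τ, t₁ + t₂, hr₁.seq hr₂, ⟨hqτ, ?_, ?_, ?_, ?_, ?_, ?_⟩, ?_⟩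
      · rw [hpτ]
        exact hσ.sub.trans (subset_insert _ _)
      · rw [hF]
        exact mem_union_left _ hσ.root
      · rw [hF]
        exact hσ.convex.union_nbr hx huF
      · rw [hF]
        intro v hv
        rcases mem_union.1 hv with hv | hv
        · exact hσ.reach v hv
        · exact (hσ.reach u huF).trans (mem_nbr.1 hv).reachable
      · rw [hpτ, hmτ]
        intro v hv w hvw
        rcases mem_insert.1 hv with rfl | hv
        · exact mem_union_right _ (mem_nbr.2 hvw)
        · exact mem_union_left _ (hσ.closed v hv w hvw)
      · obtain ⟨-, h2, h3⟩ | ⟨-, c, hc, h2, h3⟩ := hbτ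
        · obtain ⟨c, hc, hbatch⟩ := hσ.cand
          refine ⟨c, h3.trans hc, ?_⟩
          have : marked n τ 4 = marked n σ 4 := by
            rw [hmτ, union_eq_left, ← sdiff_eq_empty_iff_subset, h2]
          rwa [this]
        · rw [mem_sdiff] at hc
          -- The new vertices form the last batch; the convex set `F₀` is what had been visited
          -- before `u` was dequeued.
          refine ⟨c, h2, .inr ⟨marked n σ 4 \ D, u, huF, ?_, hσ.convex, ?_, ?_, ?_⟩⟩
          · rw [hF]
            exact subset_union_left
          · rw [hF]
            exact mem_union_right _ hc.1
          · exact fun h => hc.2 (mem_sdiff.1 h).1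
          · rw [hF]
            intro y hy hyF
            have hyu := (mem_union.1 hy).resolve_left hyF
            refine ⟨mem_nbr.1 hyu, ?_⟩
            have hyD := hnD y hyu
            -- Outside `D` the key is `n` plus the degree, so comparing keys compares degrees.
            have := h3 y (mem_sdiff.2 ⟨hyu, fun h => hyF (mem_sdiff.2 ⟨h, hyD⟩)⟩)
            rw [h7τ, hkey c (hnD c hc.1), hkey y hyD] at this
            omega
      · simp only [hpτ]
        rw [weight_compl_insert hup]
        simp only [dequeue, searchStep, visit, consider, Program.bound, Cond.cost, Expr.cost]
          at ht₁ ht₂ ⊢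
        omega) hσ₀
  refine ⟨τ, t, hr, hI, ?_, ht⟩
  have := hI.queue.le
  have : ¬ τ 11 0 < τ 12 0 := hb
  omega

end Search

end StarPartition

namespace StarPartition

open Finset

/-! ### Placing the vertices of a component -/

section Peel

variable {n s : ℕ} {G : SimpleGraph (Fin n)} {L : Fin n → List (Fin n)}

/-- The marked vertices are the first ones of the umbrella order `x`, and the block numbers are
those of this order. -/
structure IsPlaced (G : SimpleGraph (Fin n)) (s : ℕ) (x : Fin n ≃ Fin n) (σ : Mem) : Prop where
  umbrella : IsUmbrella G x
  mem : ∀ v, v ∈ marked n σ 6 ↔ (x v : ℕ) < #(marked n σ 6)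
  block : ∀ v ∈ marked n σ 6, σ 8 (v : Fin n) = x v / (s + 1)
  div : σ 19 0 = #(marked n σ 6) / (s + 1)
  mod : σ 18 0 = #(marked n σ 6) % (s + 1)

theorem IsPlaced.congr {x : Fin n ≃ Fin n} {σ τ : Mem} (h : IsPlaced G s x σ) (h6 : τ 6 = σ 6)
    (h8 : τ 8 = σ 8) (h18 : τ 18 = σ 18) (h19 : τ 19 = σ 19) : IsPlaced G s x τ := by
  have hm := marked_congr (n := n) h6
  exact ⟨h.umbrella, by rw [hm]; exact h.mem, by rw [hm, h8]; exact h.block,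
    by rw [hm, h19]; exact h.div, by rw [hm, h18]; exact h.mod⟩

/-- The memory records the order only on the marked vertices, so the order may be replaced by any
umbrella order with the same prefix. -/
theorem IsPlaced.reorder {x y : Fin n ≃ Fin n} {σ : Mem} (h : IsPlaced G s x σ)
    (hy : IsUmbrella G y) (hyx : ∀ v ∈ marked n σ 6, y v = x v)
    (hmem : ∀ v, v ∈ marked n σ 6 ↔ (y v : ℕ) < #(marked n σ 6)) : IsPlaced G s y σ :=
  ⟨hy, hmem, fun v hv => by rw [h.block v hv, hyx v hv], h.div, h.mod⟩

theorem succ_div_mod_of_eq {k s : ℕ} (h : k % (s + 1) = s) :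
    (k + 1) / (s + 1) = k / (s + 1) + 1 ∧ (k + 1) % (s + 1) = 0 := by
  rw [Nat.div_mod_unique (by omega : 0 < s + 1)]
  have := Nat.div_add_mod k (s + 1)
  rw [mul_add]
  omega

theorem succ_div_mod_of_ne {k s : ℕ} (h : k % (s + 1) ≠ s) :
    (k + 1) / (s + 1) = k / (s + 1) ∧ (k + 1) % (s + 1) = k % (s + 1) + 1 := by
  rw [Nat.div_mod_unique (by omega : 0 < s + 1)]
  have := Nat.div_add_mod k (s + 1)
  have := Nat.mod_lt k (by omega : 0 < s + 1)
  omega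

/-- Division is not available to the machine. Variable `18` counts up to `s` and wraps, and `19`
counts the wraps; together they hold the remainder and the quotient of the number of placed vertices
by `s + 1`. -/
theorem IsPlaced.exec_place {x : Fin n ≃ Fin n} {σ : Mem} (h : IsPlaced G s x σ) (hs : σ 1 0 = s)
    {c : Fin n} (hc : σ 13 0 = c) (hcx : (x c : ℕ) = #(marked n σ 6)) :
    IsPlaced G s x (place.exec σ) ∧ marked n (place.exec σ) 6 = insert c (marked n σ 6) ∧
      place.exec σ 15 0 = c := by
  obtain ⟨h15, h6, h8, h1918⟩ : place.exec σ 15 0 = c ∧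
      place.exec σ 6 = Function.update (σ 6) c 1 ∧
      place.exec σ 8 = Function.update (σ 8) c (σ 19 0) ∧
      if σ 18 0 = s then place.exec σ 19 0 = σ 19 0 + 1 ∧ place.exec σ 18 0 = 0
      else place.exec σ 19 0 = σ 19 0 ∧ place.exec σ 18 0 = σ 18 0 + 1 := by
    set υ := ((σ.write 15 0 c).write 6 c 1).write 8 c (σ 19 0) with hυ
    have h1 : (Program.store 8 (.var 15) (.var 19)).exec ((Program.store 6 (.var 15) (.lit 1)).exec
        ((Program.store 15 (.lit 0) (.var 13)).exec σ)) = υ := by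
      simp [Program.exec, Expr.eval, hc, hυ]
    have h2 : place.exec σ = (Program.ite (.eq (.var 18) (.var 1))
        (.seq (.store 19 (.lit 0) (.succ (.var 19))) (.store 18 (.lit 0) (.lit 0)))
        (.store 18 (.lit 0) (.succ (.var 18)))).exec υ := by
      rw [← h1]
      rfl
    have h3 : (Cond.eq (.var 18) (.var 1)).Holds υ ↔ σ 18 0 = s := by
      simp [Cond.Holds, Expr.eval, hυ, hs]
    simp only [h2, Program.exec, h3]
    by_cases h18 : σ 18 0 = s <;> simp [h18, hυ, Expr.eval]
  have hm := marked_of_eq_update h6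
  have hcD : c ∉ marked n σ 6 := by
    rw [h.mem, hcx]
    omega
  have hcard : #(insert c (marked n σ 6)) = #(marked n σ 6) + 1 := card_insert_of_notMem hcD
  refine ⟨⟨h.umbrella, ?_, ?_, ?_, ?_⟩, hm, h15⟩
  · intro v
    rw [hm, hcard, mem_insert, h.mem, Nat.lt_succ_iff_lt_or_eq, or_comm, ← hcx, Fin.val_inj,
      x.injective.eq_iff]
  · intro v hv
    rw [hm, mem_insert] at hv
    rw [h8, Function.update_apply]
    split_ifs with hvc
    · rw [Fin.ext hvc, hcx, h.div]
    · exact h.block v (hv.resolve_left fun h' => hvc (congrArg Fin.val h'))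
  · rw [hm, hcard]
    split_ifs at h1918 with h18
    · rw [h1918.1, h.div, (succ_div_mod_of_eq (h.mod ▸ h18)).1]
    · rw [h1918.1, h.div, (succ_div_mod_of_ne (h.mod ▸ h18)).1]
  · rw [hm, hcard]
    split_ifs at h1918 with h18
    · rw [h1918.2, (succ_div_mod_of_eq (h.mod ▸ h18)).2]
    · rw [h1918.2, h.mod, (succ_div_mod_of_ne (h.mod ▸ h18)).2]

/-- The keys of the vertices without a position, if those in `D` have one. -/
def HasKeys (G : SimpleGraph (Fin n)) (D : Finset (Fin n)) (σ : Mem) : Prop :=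
  ∀ v ∉ D, σ 7 (v : Fin n) + 2 * #(nbr G v ∩ D) = n + #(nbr G v)

theorem card_nbr_lt (v : Fin n) : #(nbr G v) < n := by
  have : nbr G v ⊂ univ := ssubset_univ_iff.2 fun h => by
    have := h ▸ mem_univ v
    simp at this
  simpa using card_lt_card this

/-- If the last placed vertex has no neighbour without a position, then the vertices with a
position form a union of components. -/
theorem IsUmbrella.isAdjClosed {x : Fin n ≃ Fin n} (hx : IsUmbrella G x) {D : Finset (Fin n)}
    (hDx : ∀ v, v ∈ D ↔ (x v : ℕ) < #D) {u : Fin n} (hu : (x u : ℕ) + 1 = #D)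
    (hnbr : nbr G u ⊆ D) : IsAdjClosed G D := by
  intro a ha b hab
  by_contra hb
  have h1 := (hDx a).1 ha
  have h2 := mt (hDx b).2 hb
  have h3 := (hx.reach (a := a) (b := u) (c := b) (by rw [Fin.le_def]; omega)
    (by rw [Fin.le_def]; omega) (.inr hab)).2
  rcases h3 with rfl | h3
  · omega
  · exact hb (hnbr (mem_nbr.2 h3))

/-- The invariant of placing the vertices of a component, if the vertices in `W` have been
visited. -/
structure PeelInv (G : SimpleGraph (Fin n)) (s : ℕ) (W : Finset (Fin n)) (σ : Mem) : Prop where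
  sub : marked n σ 6 ⊆ W
  keys : HasKeys G (marked n σ 6) σ
  placed : ∃ x, IsPlaced G s x σ ∧ (σ 14 0 ≠ 0 → ∃ c : Fin n, σ 13 0 = c ∧ c ∈ W ∧
    (x c : ℕ) = #(marked n σ 6) ∧ ∀ v ∈ W, v ∉ marked n σ 6 → G.Reachable c v)
  final : σ 14 0 = 0 → IsAdjClosed G (marked n σ 6) ∧ W ⊆ marked n σ 6

/-- Every unplaced vertex of `W` is reachable from the current candidate, so the process cannot stop
before `W` is exhausted. -/
theorem exists_run_peel (hL : IsAdjacencyList G L) {W : Finset (Fin n)} (hW : IsAdjClosed G W)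
    {σ₀ : Mem} (hin : HasInput L s σ₀) (hσ₀ : PeelInv G s W σ₀) :
    ∃ τ t, Run peel σ₀ τ t ∧ PeelInv G s W τ ∧ τ 14 0 = 0 ∧
      t + 120 * weight G (marked n τ 6)ᶜ ≤ 120 * weight G (marked n σ₀ 6)ᶜ + 5 := by
  obtain ⟨τ, t, hr, hI, hb, ht⟩ := exists_run_loop (b := .not (.eq (.var 14) (.lit 0)))
    (p := .seq (.seq place (.store 14 (.lit 0) (.lit 0))) (forNbrs 15 peelStep)) (PeelInv G s W)
    (fun σ => 120 * weight G (marked n σ 6)ᶜ) (σ₀ := σ₀) (by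
      intro σ hσ hfσ hb
      have h14 : σ 14 0 ≠ 0 := hb
      obtain ⟨x, hpl, hcand⟩ := hσ.placed
      obtain ⟨c, hc, hcW, hcx, hreach⟩ := hcand h14
      set D := marked n σ 6 with hD
      have hcD : c ∉ D := by
        rw [hpl.mem, hcx]
        exact lt_irrefl _
      have hin' : HasInput L s σ := hin.of_framed hfσ (by
        intro a ha
        simp [place, peelStep, consider]
        omega)
      obtain ⟨t₁, ht₁, hr₁⟩ := Program.LoopFree.run
        (p := .seq place (.store 14 (.lit 0) (.lit 0))) (by simp [place]) σ
      set σ₁ := (Program.seq place (.store 14 (.lit 0) (.lit 0))).exec σ with hσ₁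
      have hσ₁' : σ₁ = (place.exec σ).write 14 0 0 := rfl
      obtain ⟨hpl', hm', h15'⟩ := hpl.exec_place hin'.apply_one hc hcx
      have hpl₁ : IsPlaced G s x σ₁ :=
        hpl'.congr (by simp [hσ₁']) (by simp [hσ₁']) (by simp [hσ₁']) (by simp [hσ₁'])
      have h15₁ : σ₁ 15 0 = c := by simpa [hσ₁'] using h15'
      have h14₁ : σ₁ 14 0 = 0 := by simp [hσ₁']
      have h7₁ : σ₁ 7 = σ 7 := hr₁.framed 7 (by simp [place])
      set D₁ := marked n σ₁ 6 with hD₁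
      have hD₁' : D₁ = insert c D := by
        rw [hD₁, marked_congr (τ := σ₁) (σ := place.exec σ) (by simp [hσ₁']), hm']
      have hin₁ : HasInput L s σ₁ := hin'.of_framed hr₁.framed (by
        intro a ha
        simp [place]
        omega)
      obtain ⟨τ, t₂, hr₂, ⟨hkτ, hbτ⟩, ht₂⟩ := exists_run_forNbrs (a := 15) hL
        (v := c) (body := peelStep)
        -- When `c` is placed, each unplaced neighbour has one neighbour fewer outside and one more
        -- inside the prefix, so its key drops by 2.
        (fun S τ => (∀ v : Fin n, τ 7 v + (if v ∈ S \ D₁ then 2 else 0) = σ 7 v) ∧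
          IsBest (S \ D₁) (σ₁ 13 0) τ)
        (by
          rintro S τ i y hi ⟨h1, h2⟩
          have hne : ∀ b < 16, (τ.write i 0 y) b = τ b := by
            intro b hb
            rw [Mem.write_apply, if_neg (by omega)]
          refine ⟨?_, h2.congr (hne _ (by simp)) (hne _ (by simp)) fun _ _ => ?_⟩
          · rw [hne 7 (by simp)]; exact h1
          · rw [hne 7 (by simp)])
        (by simp [peelStep, consider])
        (by intro b hb; simp [peelStep, consider]; omega) (by simp) hin₁ h15₁ (by
          rintro S w τ - hcw hwS ⟨h1, h2⟩ hf h17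
          have h6 : τ 6 = σ₁ 6 := hf 6 (by simp [peelStep, consider])
          have hc' : (Cond.eq (.cell 6 (.var 17)) (.lit 0)).Holds τ ↔ w ∉ D₁ := by
            simp [Cond.Holds, Expr.eval, h17, hD₁, h6]
          simp only [peelStep, Program.exec, hc']
          by_cases hw : w ∉ D₁
          · rw [if_pos hw]
            set υ := τ.write 7 ((Expr.var 17).eval τ)
              ((Expr.cell 7 (.var 17)).pred.pred.eval τ) with hυ
            have hυ7 : υ 7 = Function.update (τ 7) w (τ 7 w - 2) := by
              simp [hυ, Expr.eval, h17, Nat.sub_sub]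
            have hυne : ∀ b, b ≠ 7 → υ b = τ b := fun b hb => by simp [hυ, hb]
            have hfc : Framed consider υ (consider.exec υ) :=
              Program.LoopFree.framed (by simp [consider]) _
            -- Subtraction must not truncate. Since `c` is a neighbour of `w` outside `D`, fewer
            -- than all neighbours of `w` lie in `D`; as the degree is below `n`, the offset `n`
            -- keeps the key large enough.
            have hw7 : 2 ≤ τ 7 w := by
              have h3 := h1 w
              rw [if_neg (by simp [hwS])] at h3
              have hwD : w ∉ D := fun h => hw (hD₁' ▸ mem_insert_of_mem h)
              have h4 := hσ.keys w hwD
              have h5 := card_nbr_lt (G := G) w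
              have h6 : #(nbr G w ∩ D) < #(nbr G w) := card_lt_card
                ⟨inter_subset_left, fun h => hcD (mem_inter.1 (h (mem_nbr.2 hcw.symm))).2⟩
              rw [← hD] at h4
              omega
            rw [insert_sdiff_of_notMem _ hw]
            refine ⟨fun v => ?_, ?_⟩
            · rw [hfc 7 (by simp [consider]), hυ7, Function.update_apply]
              have h3 := h1 v
              split_ifs with hvw hv hv
              · obtain rfl := Fin.ext hvw
                rw [if_neg (by simp [hwS])] at h3
                omega
              · exact absurd (mem_insert.2 (.inl (Fin.ext hvw))) hv
              · rwa [if_pos ((mem_insert.1 hv).resolve_left fun h => hvw (congrArg Fin.val h))]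
                  at h3
              · rwa [if_neg fun h => hv (mem_insert_of_mem h)] at h3
            · refine (h2.congr (hυne 13 (by simp)) (hυne 14 (by simp)) fun y hy => ?_).consider ?_
              · rw [hυ7, Function.update_of_ne]
                intro h
                obtain rfl := Fin.ext h
                exact hwS (mem_sdiff.1 hy).1
              · rw [hυne 17 (by simp), h17]
          · rw [if_neg hw, insert_sdiff_of_mem _ (not_not.1 hw)]
            exact ⟨h1, h2⟩)
        ⟨by simp [h7₁], .inl ⟨h14₁, by simp, rfl⟩⟩
      have hf₂ : ∀ b < 13, b ≠ 7 → τ b = σ₁ b := fun b hb hb' =>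
        hr₂.framed b (by simp [peelStep, consider]; omega)
      have hmτ : marked n τ 6 = D₁ := marked_congr (hf₂ 6 (by simp) (by simp))
      have hplτ : IsPlaced G s x τ := hpl₁.congr (hf₂ 6 (by simp) (by simp))
        (hf₂ 8 (by simp) (by simp)) (hr₂.framed 18 (by simp [peelStep, consider]))
        (hr₂.framed 19 (by simp [peelStep, consider]))
      have hkeys : HasKeys G D₁ τ := by
        intro v hv
        have hv' : v ∉ D := fun h => hv (hD₁' ▸ mem_insert_of_mem h)
        have h1 := hkτ v
        have h2 := hσ.keys v hv'
        rw [← hD] at h2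
        by_cases hcv : G.Adj c v
        · rw [if_pos (by simp [hcv, hv])] at h1
          rw [hD₁', inter_insert_of_mem (mem_nbr.2 hcv.symm),
            card_insert_of_notMem (by simp [hcD])]
          omega
        · rw [if_neg (by simp [hcv])] at h1
          rw [hD₁', inter_insert_of_notMem (by simpa [G.adj_comm] using hcv)]
          omega
      have hcard : #D₁ = #D + 1 := by rw [hD₁', card_insert_of_notMem hcD]
      have hreach₁ : ∀ v ∈ W, v ∉ D₁ → G.Reachable c v := fun v hv hv' =>
        hreach v hv fun h => hv' (hD₁' ▸ mem_insert_of_mem h)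
      refine ⟨τ, t₁ + t₂, hr₁.seq hr₂, ⟨?_, hmτ ▸ hkeys, ?_, ?_⟩, ?_⟩
      · rw [hmτ, hD₁']
        exact insert_subset hcW hσ.sub
      · obtain ⟨h1, h2, -⟩ | ⟨h1, w, hw, h2, h3⟩ := hbτ
        · exact ⟨x, hplτ, fun h => absurd h1 h⟩
        obtain ⟨hcw, hwD⟩ := mem_sdiff.1 hw
        rw [mem_nbr] at hcw
        obtain ⟨y, hy, hyx, hyD, hyw⟩ := hpl₁.umbrella.exists_next (D := D₁) hpl₁.mem (u := c) (w := w)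
          (by rw [hcx, hcard]) hcw hwD (by
            intro y hcy hyD
            have h4 := h3 y (mem_sdiff.2 ⟨mem_nbr.2 hcy, hyD⟩)
            have h5 := hkeys w hwD
            have h6 := hkeys y hyD
            -- Splitting each degree at `D₁` turns the comparison of keys into that of new minus old
            -- neighbours.
            have h7 := card_sdiff_add_card_inter (nbr G w) D₁
            have h8 := card_sdiff_add_card_inter (nbr G y) D₁
            omega)
        rw [← hmτ] at hyx hyD hyw
        refine ⟨y, hplτ.reorder hy hyx hyD, fun _ => ⟨w, h2, hW c hcW w hcw, hyw, ?_⟩⟩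
        intro v hv hv'
        exact hcw.symm.reachable.trans (hreach₁ v hv (hmτ ▸ hv'))
      · intro h0
        -- Without a candidate the prefix is a union of components. It contains `c`, hence
        -- everything reachable from `c`, hence all of `W`.
        obtain ⟨-, h2, -⟩ | ⟨h1, -⟩ := hbτ
        · rw [hmτ]
          have hcl : IsAdjClosed G D₁ := hpl₁.umbrella.isAdjClosed (D := D₁) hpl₁.mem (u := c)
            (by rw [hcx, hcard]) (sdiff_eq_empty_iff_subset.1 h2)
          refine ⟨hcl, fun v hv => ?_⟩
          by_contra hv'
          exact hv' (hcl.mem_of_reachable (hD₁' ▸ mem_insert_self c D) (hreach₁ v hv hv'))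
        · exact absurd h0 h1
      · simp only [hmτ, hD₁']
        rw [weight_compl_insert hcD]
        simp only [place, peelStep, consider, Program.bound, Cond.cost, Expr.cost] at ht₁ ht₂ ⊢
        omega) hσ₀
  exact ⟨τ, t, hr, hI, not_not.1 hb, ht⟩

end Peel

end StarPartition

namespace StarPartition

open Finset

/-! ### Assembling the components and the final bound -/

section Correctness

variable {n s : ℕ} {G : SimpleGraph (Fin n)} {L : Fin n → List (Fin n)}

/-- The invariant of the computation of the blocks, when the components of the first `k` vertices
have been treated. -/
structure BlocksInv (G : SimpleGraph (Fin n)) (s k : ℕ) (σ : Mem) : Prop where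
  queue : IsQueue n σ
  empty : σ 11 0 = σ 12 0
  visited : marked n σ 4 = marked n σ 6
  closed : IsAdjClosed G (marked n σ 6)
  mem : ∀ v : Fin n, (v : ℕ) < k → v ∈ marked n σ 6
  keys : HasKeys G (marked n σ 6) σ
  placed : ∃ x, IsPlaced G s x σ

theorem BlocksInv.congr {k : ℕ} {σ τ : Mem} (h : BlocksInv G s k σ)
    (hστ : ∀ a, a ≠ 10 → τ a = σ a) : BlocksInv G s k τ := by
  have h4 : marked n τ 4 = marked n σ 4 := marked_congr (hστ 4 (by simp))
  have h6 : marked n τ 6 = marked n σ 6 := marked_congr (hστ 6 (by simp))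
  refine ⟨h.queue.congr ?_ ?_ ?_ ?_, ?_, ?_, h6 ▸ h.closed, h6 ▸ h.mem, ?_, ?_⟩
  · exact hστ 4 (by simp)
  · exact hστ 5 (by simp)
  · exact hστ 11 (by simp)
  · exact hστ 12 (by simp)
  · rw [hστ 11 (by simp), hστ 12 (by simp), h.empty]
  · rw [h4, h6, h.visited]
  · rw [HasKeys, h6, hστ 7 (by simp)]
    exact h.keys
  · obtain ⟨x, hx⟩ := h.placed
    exact ⟨x, hx.congr (hστ 6 (by simp)) (hστ 8 (by simp)) (hστ 18 (by simp)) (hστ 19 (by simp))⟩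

/-- Between components this makes every remaining key equal to `n` plus the degree, as the next
search requires; nothing has to be reset. -/
theorem IsAdjClosed.card_nbr_inter {D : Finset (Fin n)} (hD : IsAdjClosed G D) {v : Fin n}
    (hv : v ∉ D) : #(nbr G v ∩ D) = 0 := by
  rw [card_eq_zero, ← disjoint_iff_inter_eq_empty, disjoint_left]
  exact fun w hw hwD => hv (hD w hwD v (mem_nbr.1 hw).symm)

/-- The queue is never cleared: its part before the head is the set of all vertices searched so far,
which is `D` when a new component starts. Search and placing have separate potentials, since each
scans every adjacency list once. -/
theorem exists_run_component (hL : IsAdjacencyList G L) {r : Fin n} {σ : Mem}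
    (hin : HasInput L s σ) (hσ : BlocksInv G s r σ) (hr : σ 10 0 = r) (hr4 : r ∉ marked n σ 4) :
    ∃ τ t, Run (.seq (.seq (visit 10) (.store 13 (.lit 0) (.var 10)))
        (.seq search (.seq (.store 14 (.lit 0) (.lit 1)) peel))) σ τ t ∧
      BlocksInv G s (r + 1) τ ∧
      t + 100 * weight G (processed n τ)ᶜ + 120 * weight G (marked n τ 6)ᶜ ≤
        100 * weight G (processed n σ)ᶜ + 120 * weight G (marked n σ 6)ᶜ + 50 := by
  obtain ⟨x, hpl⟩ := hσ.placed
  set D := marked n σ 6 with hD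
  have hrD : r ∉ D := by rwa [hD, ← hσ.visited]
  obtain ⟨t₁, ht₁, hr₁⟩ := Program.LoopFree.run
    (p := .seq (visit 10) (.store 13 (.lit 0) (.var 10))) (by simp [visit]) σ
  set σ₁ := (Program.seq (visit 10) (.store 13 (.lit 0) (.var 10))).exec σ with hσ₁
  have hσ₁' : σ₁ = ((visit 10).exec σ).write 13 0 ((visit 10).exec σ 10 0) := rfl
  have hfr₁ : ∀ a, a ≠ 4 → a ≠ 5 → a ≠ 12 → a ≠ 13 → σ₁ a = σ a := fun a h1 h2 h3 h4 =>
    hr₁.framed a (by simp [visit, h1, h2, h3, h4])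
  obtain ⟨hq, hm, h12, h5⟩ := hσ.queue.visit (a := 10) (by simp) hr hr4
  have hq₁ : IsQueue n σ₁ := hq.congr (by simp [hσ₁']) (by simp [hσ₁']) (by simp [hσ₁'])
    (by simp [hσ₁'])
  have hm₁ : marked n σ₁ 4 = insert r D := by
    rw [marked_congr (τ := σ₁) (σ := (visit 10).exec σ) (by simp [hσ₁']), hm, hσ.visited]
  have h13₁ : σ₁ 13 0 = r := by
    have : (visit 10).exec σ 10 0 = σ 10 0 := by simp [visit_exec]
    simp [hσ₁', this, hr]
  have hp₁ : processed n σ₁ = processed n σ := by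
    ext v
    have h5' : σ₁ 5 = (visit 10).exec σ 5 := by simp [hσ₁']
    rw [mem_processed, mem_processed, hfr₁ 11 (by simp) (by simp) (by simp) (by simp), h5']
    refine exists_congr fun j => and_congr_right fun hj => ?_
    rw [h5 j (hσ.empty ▸ hj)]
  have hpD : processed n σ = D := by rw [hσ.queue.processed_eq hσ.empty, hσ.visited]
  have hF₁ : marked n σ₁ 4 \ D = {r} := by
    rw [hm₁, insert_sdiff_of_notMem _ hrD, sdiff_self]
    rfl
  have hin₁ : HasInput L s σ₁ := hin.of_framed hr₁.framed (by
    intro a ha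
    simp [visit]
    omega)
  have h7₁ : σ₁ 7 = σ 7 := hfr₁ 7 (by simp) (by simp) (by simp) (by simp)
  have hS₁ : SearchInv G x D r σ₁ := by
    refine ⟨hq₁, by rw [hp₁, hpD], by simp [hF₁], ?_, ?_, ?_, r, h13₁, .inl hF₁⟩
    · rw [hF₁]
      intro a ha c hc b hab hbc
      rw [mem_singleton] at ha hc
      subst ha hc
      exact absurd (hab.trans hbc) (lt_irrefl _)
    · rw [hF₁]
      intro v hv
      rw [mem_singleton.1 hv]
    · rw [hp₁, hpD, hm₁]
      exact fun v hv w hvw => mem_insert_of_mem (hσ.closed v hv w hvw)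
  have hkey₁ : ∀ v ∉ D, σ₁ 7 (v : Fin n) = n + #(nbr G v) := by
    intro v hv
    have := hσ.keys v hv
    rw [hσ.closed.card_nbr_inter hv] at this
    rw [h7₁]
    omega
  obtain ⟨σ₂, t₂, hr₂, hS₂, hemp₂, ht₂⟩ :=
    exists_run_search hL hpl.umbrella hσ.closed hin₁ hkey₁ hS₁
  have hfr₂ : ∀ a, a < 4 ∨ a = 6 ∨ a = 7 ∨ a = 8 ∨ a = 18 ∨ a = 19 → σ₂ a = σ a := fun a ha => by
    rw [hr₂.framed a (by simp [search, dequeue, searchStep, visit, consider]; omega),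
      hfr₁ a (by omega) (by omega) (by omega) (by omega)]
  have hp₂ : processed n σ₂ = marked n σ₂ 4 := hS₂.queue.processed_eq hemp₂
  set W := marked n σ₂ 4 with hW
  have hWcl : IsAdjClosed G W := fun v hv => hS₂.closed v (hp₂ ▸ hv)
  have hDW : D ⊆ W := hp₂ ▸ hS₂.sub
  have hFcl : IsAdjClosed G (W \ D) := by
    intro a ha b hab
    rw [mem_sdiff] at ha ⊢
    exact ⟨hWcl a ha.1 b hab, fun hb => ha.2 (hσ.closed b hb a hab.symm)⟩
  obtain ⟨c, hc, hbatch⟩ := hS₂.cand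
  -- The search has closed up the component `W \ D`, so its last candidate may be put at the first
  -- free position.
  obtain ⟨y, hy, hyx, hyD, hyc⟩ := hpl.umbrella.exists_start hσ.closed hpl.mem hFcl
    disjoint_sdiff hbatch
  have hcF : c ∈ W \ D := hbatch.mem
  set σ₃ := σ₂.write 14 0 1 with hσ₃
  have hr₃ : Run (.store 14 (.lit 0) (.lit 1)) σ₂ σ₃ 3 := .store σ₂ 14 (.lit 0) (.lit 1)
  have hfr₃ : ∀ a, a ≠ 14 → σ₃ a = σ₂ a := fun a ha => by simp [hσ₃, ha]
  have hm₃ : marked n σ₃ 6 = D :=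
    marked_congr (by rw [hfr₃ 6 (by simp), hfr₂ 6 (by simp)])
  have hP₃ : PeelInv G s W σ₃ := by
    refine ⟨hm₃ ▸ hDW, ?_, ⟨y, ?_, fun _ => ⟨c, ?_, (mem_sdiff.1 hcF).1, hm₃ ▸ hyc, ?_⟩⟩, ?_⟩
    · rw [HasKeys, hm₃, hfr₃ 7 (by simp), hfr₂ 7 (by simp)]
      exact hσ.keys
    · refine (hpl.reorder hy hyx hyD).congr ?_ ?_ ?_ ?_ <;>
        rw [hfr₃ _ (by simp), hfr₂ _ (by simp)]
    · rw [hfr₃ 13 (by simp), hc]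
    · rw [hm₃]
      intro v hv hvD
      exact (hS₂.reach c hcF).symm.trans (hS₂.reach v (mem_sdiff.2 ⟨hv, hvD⟩))
    · intro h
      simp [hσ₃] at h
  have hin₃ : HasInput L s σ₃ := fun a ha => by
    rw [hfr₃ a (by omega), hfr₂ a (.inl ha), hin a ha]
  obtain ⟨τ, t₄, hr₄, hP, h14, ht₄⟩ := exists_run_peel hL hWcl hin₃ hP₃
  obtain ⟨hcl, hWτ⟩ := hP.final h14
  have hWeq : marked n τ 6 = W := hP.sub.antisymm hWτ
  have hfr₄ : ∀ a, a = 4 ∨ a = 5 ∨ a = 11 ∨ a = 12 → τ a = σ₂ a := fun a ha => by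
    rw [hr₄.framed a (by simp [peel, place, peelStep, consider]; omega), hfr₃ a (by omega)]
  have hm4 : marked n τ 4 = W := marked_congr (hfr₄ 4 (by simp))
  have hqτ : IsQueue n τ := hS₂.queue.congr (hfr₄ 4 (by simp)) (hfr₄ 5 (by simp))
    (hfr₄ 11 (by simp)) (hfr₄ 12 (by simp))
  have hemp : τ 11 0 = τ 12 0 := by rw [hfr₄ 11 (by simp), hfr₄ 12 (by simp), hemp₂]
  refine ⟨τ, t₁ + (t₂ + (3 + t₄)), hr₁.seq (hr₂.seq (hr₃.seq hr₄)), ?_, ?_⟩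
  · refine ⟨hqτ, hemp, by rw [hm4, hWeq], hcl, fun v hv => ?_, hP.keys, ?_⟩
    · rw [hWeq]
      rcases Nat.lt_succ_iff_lt_or_eq.1 hv with hv | hv
      · exact hDW (hσ.mem v hv)
      · rw [Fin.ext hv]
        exact (mem_sdiff.1 hS₂.root).1
    · obtain ⟨z, hz, -⟩ := hP.placed
      exact ⟨z, hz⟩
  · rw [hqτ.processed_eq hemp, hm4, hWeq]
    rw [hp₂, hp₁] at ht₂
    rw [hWeq, hm₃] at ht₄
    simp only [visit, Program.bound, Expr.cost] at ht₁
    omega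

theorem exists_run_computeBlocks (hL : IsAdjacencyList G L) {σ₀ : Mem} (hin : HasInput L s σ₀)
    (hσ₀ : BlocksInv G s 0 σ₀) :
    ∃ τ t, Run computeBlocks σ₀ τ t ∧ BlocksInv G s n τ ∧
      t ≤ 220 * weight G univ + 100 * (n + 1) := by
  obtain ⟨τ, t, hr, hI, ht⟩ := exists_run_forRange (v := 10) (a := 0) (N := n)
    (body := .ite (.eq (.cell 4 (.var 10)) (.lit 0))
      (.seq (.seq (visit 10) (.store 13 (.lit 0) (.var 10)))
        (.seq search (.seq (.store 14 (.lit 0) (.lit 1)) peel))) .skip)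
    (BlocksInv G s)
    -- The two weights pay for search and placing over all components; 60 per vertex covers the
    -- overhead of 50 for starting a component and the test of the visited mark.
    (fun k σ => 100 * weight G (processed n σ)ᶜ + 120 * weight G (marked n σ 6)ᶜ + 60 * (n - k))
    (fun k σ y h => h.congr fun a ha => by simp [ha])
    (fun k σ y => by
      rw [marked_congr (τ := σ.write 10 0 y) (σ := σ) (by simp)]
      congr 4)
    (by simp [visit, search, dequeue, searchStep, consider, peel, place, peelStep])
    (by simp [visit, search, dequeue, searchStep, consider, peel, place, peelStep])
    (by simp) hin.apply_zero (by
      intro k hk σ hσ hf hv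
      have hin' : HasInput L s σ := hin.of_framed hf (by
        intro a ha
        simp [visit, search, dequeue, searchStep, consider, peel, place, peelStep]
        omega)
      have hc : (Cond.eq (.cell 4 (.var 10)) (.lit 0)).Holds σ ↔ (⟨k, hk⟩ : Fin n) ∉ marked n σ 4 := by
        simp [Cond.Holds, Expr.eval, hv]
      by_cases hk4 : (⟨k, hk⟩ : Fin n) ∈ marked n σ 4
      · refine ⟨σ, _, .iteFalse (mt hc.1 (not_not.2 hk4)) (.skip σ), ?_, ?_⟩
        · refine ⟨hσ.queue, hσ.empty, hσ.visited, hσ.closed, fun v hv => ?_, hσ.keys, hσ.placed⟩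
          rcases Nat.lt_succ_iff_lt_or_eq.1 hv with hv | hv
          · exact hσ.mem v hv
          · rw [← hσ.visited]
            exact (Fin.ext hv : v = ⟨k, hk⟩) ▸ hk4
        · simp only [Cond.cost, Expr.cost]
          omega
      · obtain ⟨τ, t, hr, hI, ht⟩ := exists_run_component hL (r := ⟨k, hk⟩) hin' hσ hv hk4
        refine ⟨τ, _, .iteTrue (hc.2 hk4) hr, hI, ?_⟩
        simp only [Cond.cost, Expr.cost]
        omega) hσ₀
  refine ⟨τ, t, hr, hI, ?_⟩
  have h1 := weight_le_univ (G := G) (processed n σ₀)ᶜ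
  have h2 := weight_le_univ (G := G) (marked n σ₀ 6)ᶜ
  omega

theorem hasInput_inputMem (L : Fin n → List (Fin n)) (s : ℕ) : HasInput L s (inputMem L s) :=
  fun _ _ => rfl

theorem inputMem_of_four_le (L : Fin n → List (Fin n)) (s : ℕ) {a : ℕ} (ha : 4 ≤ a) (i : ℕ) :
    inputMem L s a i = 0 := by
  obtain ⟨b, rfl⟩ := Nat.exists_eq_add_of_le' ha
  rfl

theorem exists_run_starPartitionProgram (hG : IsUnitIntervalGraph G) (hL : IsAdjacencyList G L)
    (s : ℕ) :
    ∃ τ t, Run starPartitionProgram (inputMem L s) τ t ∧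
      t ≤ 1000 * (n + G.edgeSet.ncard + 1) ∧
      (HasStarPartition G s → τ 0 0 = 1) ∧ (¬ HasStarPartition G s → τ 0 0 = 0) := by
  classical
  have hin := hasInput_inputMem L s
  obtain ⟨x₀, hx₀⟩ := hG.exists_isUmbrella
  obtain ⟨σ₁, t₁, hr₁, hkey, ht₁⟩ := exists_run_initKeys hL hin
  have hz₁ : ∀ a, 4 ≤ a → a ≠ 7 → a ≠ 10 → a ≠ 16 → a ≠ 17 → ∀ i, σ₁ a i = 0 := by
    intro a h1 h2 h3 h4 h5 i
    rw [hr₁.framed a (by simp [initKeys, *]), inputMem_of_four_le L s h1]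
  have hin₁ : HasInput L s σ₁ := hin.of_framed hr₁.framed (by
    intro a ha
    simp [initKeys]
    omega)
  have hm4 : marked n σ₁ 4 = ∅ := by
    ext v
    simp [hz₁ 4]
  have hm6 : marked n σ₁ 6 = ∅ := by
    ext v
    simp [hz₁ 6]
  have hB₁ : BlocksInv G s 0 σ₁ := by
    refine ⟨⟨?_, ?_, ?_, ?_⟩, ?_, ?_, ?_, ?_, ?_, x₀, hx₀, ?_, ?_, ?_, ?_⟩
    · simp [hz₁ 11, hz₁ 12]
    · simp [hz₁ 12]
    · simp [hz₁ 12]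
    · simp [hm4, hz₁ 12]
    · simp [hz₁ 11, hz₁ 12]
    · rw [hm4, hm6]
    · simp [hm6, IsAdjClosed]
    · simp
    · intro v _
      simp [hm6, hkey]
    · simp [hm6]
    · simp [hm6]
    · simp [hm6, hz₁ 19]
    · simp [hm6, hz₁ 18]
  obtain ⟨σ₂, t₂, hr₂, hB, ht₂⟩ := exists_run_computeBlocks hL hin₁ hB₁
  have hin₂ : HasInput L s σ₂ := hin₁.of_framed hr₂.framed (by
    intro a ha
    simp [computeBlocks, visit, search, dequeue, searchStep, consider, peel, place, peelStep]
    omega)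
  have h9 : ∀ b, σ₂ 9 b = 0 := by
    intro b
    rw [hr₂.framed 9 (by simp [computeBlocks, visit, search, dequeue, searchStep, consider, peel,
      place, peelStep]), hz₁ 9 (by simp) (by simp) (by simp) (by simp) (by simp)]
  obtain ⟨x, hpl⟩ := hB.placed
  have huniv : marked n σ₂ 6 = univ := eq_univ_of_forall fun v => hB.mem v v.2
  have hblk : ∀ v : Fin n, σ₂ 8 v = x v / (s + 1) := fun v => hpl.block v (huniv ▸ mem_univ v)
  have h19 : σ₂ 19 0 = n / (s + 1) := by simpa [huniv] using hpl.div
  have h18 : σ₂ 18 0 = n % (s + 1) := by simpa [huniv] using hpl.mod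
  obtain ⟨σ₃, t₃, hr₃, hgood, ht₃⟩ := exists_run_markStars hL hin₂ h9
  obtain ⟨τ, t₄, hr₄, hans, ht₄⟩ := exists_run_decideBlocks σ₃
  have hf₃ : ∀ a, a = 18 ∨ a = 19 → σ₃ a = σ₂ a := fun a ha =>
    hr₃.framed a (by simp [markStars]; omega)
  have hiff : (σ₃ 18 0 = 0 ∧ ∀ b < σ₃ 19 0, σ₃ 9 b ≠ 0) ↔ HasStarPartition G s := by
    rw [hpl.umbrella.hasStarPartition_iff, hf₃ 18 (by simp), hf₃ 19 (by simp), h18, h19]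
    simp only [hgood, hblk]
  refine ⟨τ, t₁ + (t₂ + (t₃ + t₄)), hr₁.seq (hr₂.seq (hr₃.seq hr₄)), ?_, ?_, ?_⟩
  -- The passes cost `50 + 220 + 70 = 340` times `2m + n`, plus at most `150(n + 1)`.
  · rw [weight_univ] at ht₁ ht₂ ht₃
    rw [hf₃ 19 (by simp), h19] at ht₄
    have := Nat.div_le_self n (s + 1)
    omega
  · intro h
    rw [hans, if_pos (hiff.2 h)]
  · intro h
    rw [hans, if_neg (mt hiff.1 h)]

end Correctness

end StarPartition

theorem theorem1 :
    ∃ (prog : StarPartition.Program) (c : ℕ),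
      ∀ (n s : ℕ) (G : SimpleGraph (Fin n)) (L : Fin n → List (Fin n)),
        StarPartition.IsUnitIntervalGraph G →
        StarPartition.IsAdjacencyList G L →
        ∃ (τ : StarPartition.Mem) (t : ℕ),
          StarPartition.Run prog (StarPartition.inputMem L s) τ t ∧
          t ≤ c * (n + G.edgeSet.ncard + 1) ∧
          (StarPartition.HasStarPartition G s → τ 0 0 = 1) ∧
          (¬ StarPartition.HasStarPartition G s → τ 0 0 = 0) :=
  ⟨StarPartition.starPartitionProgram, 1000, fun _ s _ _ hG hL =>
    StarPartition.exists_run_starPartitionProgram hG hL s⟩
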